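/- Let $k$ be a field of characteristic $p>0$ and let $H$ be a finite-dimensional pointed Hopf algebra over $k$, with coradical filtration $(H_i)_{i\ge 0}$, where $H_0$ is the sum of the simple subcoalgebras and $H_{i+1}=\Delta^{-1}(H\otimes H_i+H_0\otimes H)$. Assume that $H$ has rank one, i.e. $\dim_k(k\otimes_{H_0}H_1)=2$ (where $k$ is an $H_0$-module through the counit), and that $H$ is generated as an algebra by $H_1$. For group-like $g,h$ write $P_{g,h}=\{c\in H:\Delta(c)=c\otimes g+h\otimes c\}$. Let $a\in H$ be group-like and let $x\in P_{a,1}\setminus H_0$ satisfy $axa^{-1}=qx$ with $q\in k$. *First type.* Let $R=(G,\chi,a,(\alpha_{-1},\alpha_0,\dots,\alpha_{r-1}))$, where $G$ is a finite group, $a\in Z(G)$, $\chi:G\to k^*$ is a homomorphism with $\chi(a)\ne1$, $\alpha_i\in k$ and $r\ge 0$. Let $N$ be the order of $\chi(a)$ and $n=p^rN$. Assume that $\alpha_{-1}=0$ if $a^n=1$; that $a^{N(p^r-p^i)}=1$ and $\chi(g)^{N(p^r-p^i)}=1$ for all $g\in G$ whenever $\alpha_i\neq 0$ for some $0\le i\le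 r-1$; and that $\chi(g)^{Np^r}=1$ for all $g\in G$ if $\alpha_{-1}\ne0$. Then $H_R$ is the Hopf algebra generated as an algebra by the group $G$ and an element $x$ with relations $gxg^{-1}=\chi(g)x$ ($g\in G$) and $x^n=\alpha_{-1}(a^n-1)+\sum_{i=0}^{r-1}\alpha_i x^{p^iN}$, with basis $\{gx^i: g\in G,\ 0\le i\le n-1\}$. *Second type.* Let $F=(G,\chi,c,a,(\alpha_{-1},\alpha_0))$, where $G$ is a finite group, $a\in Z(G)$, $\chi:G\to k^*$ is a homomorphism with $\chi(a)=1$, and $c:G\to k$ satisfies $c(hg)=\chi(g)c(h)+c(g)$ for all $g,h\in G$ and $c(a)=0$. Assume that $\alpha_{-1}\in k$, $\alpha_0\in\{0,1\}$, and $\alpha_{-1}=0$ if $\alpha_0=0$; that, if $\alpha_0=0$, then $c(g)(a^p-1)=0$ in $kG$ for all $g\in G$; and that, if $\alpha_0=1$, then $a^p=a$, $\chi(g)\in\mathbb F_p^*$ and $(\alpha_{-1}(\chi(g)-1)+c(g)^p-c(g))(a-1)=0$ in $kG$ for all $g\in G$. Then $H_F$ is the Hopf algebra generated as an algebra by the group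 $G$ and an element $x$ with relations $gxg^{-1}=\chi(g)x+c(g)(a-1)$ ($g\in G$) and $x^p=\alpha_{-1}(a^p-1)+\alpha_0x$, with basis $\{gx^i: g\in G,\ 0\le i\le p-1\}$. In both cases the Hopf algebra structure is given by $\Delta(g)=g\otimes g$, $\Delta(x)=x\otimes a+1\otimes x$, $\varepsilon(g)=1$, $\varepsilon(x)=0$, $S(g)=g^{-1}$, $S(x)=-xa^{-1}$. **Theorem.** If $q\neq1$, then $H$ is isomorphic, as a Hopf algebra, to $H_R$ for some tuple $R$ of the first type with $r=0$. If $q=1$ and $k$ is algebraically closed, then $H$ is isomorphic, as a Hopf algebra, to $H_F$ for some tuple $F$ of the second type. -/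

import Mathlib

open scoped TensorProduct

universe u v

noncomputable section

namespace RankOne

/-! ### Coradical filtration, pointedness, skew primitive elements, rank -/

section Coalgebra

variable (k : Type u) {H : Type v} [Field k] [AddCommGroup H] [Module k H] [Coalgebra k H]

/-- The image of `U ⊗ V` in `H ⊗ H`. -/
def tensorSub (U V : Submodule k H) : Submodule k (H ⊗[k] H) :=
  LinearMap.range (TensorProduct.mapIncl U V)

/-- `D` is a subcoalgebra: `Δ(D) ⊆ D ⊗ D`. -/
def IsSubcoalgebra (D : Submodule k H) : Prop :=
  ∀ d ∈ D, Coalgebra.comul (R := k) d ∈ tensorSub k D D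

/-- A nonzero subcoalgebra without proper nonzero subcoalgebras. -/
def IsSimpleSubcoalgebra (D : Submodule k H) : Prop :=
  IsSubcoalgebra k D ∧ D ≠ ⊥ ∧
    ∀ E : Submodule k H, IsSubcoalgebra k E → E ≤ D → E = ⊥ ∨ E = D

variable (H) in
/-- `H` is pointed: every simple subcoalgebra is one-dimensional. -/
def IsPointed : Prop :=
  ∀ D : Submodule k H, IsSimpleSubcoalgebra k D → Module.finrank k D = 1

variable (H) in
/-- The coradical `H₀`, the sum of all simple subcoalgebras. -/
def coradical : Submodule k H :=
  sSup {D | IsSimpleSubcoalgebra k D}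

variable (H) in
/-- The coradical filtration `H_{i+1} = Δ⁻¹(H ⊗ H_i + H₀ ⊗ H)`. -/
def coradicalFiltration : ℕ → Submodule k H
  | 0 => coradical k H
  | i + 1 => Submodule.comap (Coalgebra.comul (R := k) (A := H))
      (tensorSub k ⊤ (coradicalFiltration i) ⊔ tensorSub k (coradical k H) ⊤)

/-- The set `P_{g,h}` of `(g,h)`-primitive elements (for group-like `g` and `h`). -/
def skewPrimitives (g h : GroupLike k H) : Set H :=
  {c | Coalgebra.comul (R := k) c = c ⊗ₜ[k] (g : H) + (h : H) ⊗ₜ[k] c}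

end Coalgebra

section Rank

variable (k : Type u) (H : Type v) [Field k] [Ring H] [HopfAlgebra k H]

/-- The relations `s·h ⊗ m = s ⊗ h m` (`s ∈ k`, `h ∈ H₀`, `m ∈ H₁`, `s·h = s ε(h)`) that turn
`k ⊗_k H₁` into `k ⊗_{H₀} H₁`. The existence of `m'` with `m' = h m` in `H₁` is automatic when
`H₀ H₁ ⊆ H₁`, in particular when `H` is pointed. -/
def balancedRelations : Submodule k (k ⊗[k] coradicalFiltration k H 1) :=
  Submodule.span k {t | ∃ (s : k) (h : H) (m m' : coradicalFiltration k H 1),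
    h ∈ coradicalFiltration k H 0 ∧ (m' : H) = h * (m : H) ∧
      t = (s * Coalgebra.counit (R := k) h) ⊗ₜ[k] m - s ⊗ₜ[k] m'}

/-- `H` has rank `t`: `dim (k ⊗_{H₀} H₁) = t + 1`. -/
def HasRank (t : ℕ) : Prop :=
  Module.finrank k ((k ⊗[k] coradicalFiltration k H 1) ⧸ balancedRelations k H) = t + 1

end Rank

/-! ### Powers of sums of commuting or `q`-commuting elements -/

theorem add_pow_char_pow_aux {k : Type u} [Field k] (p : ℕ) [Fact p.Prime] [CharP k p]
    {B : Type*} [Ring B] [Algebra k B] {A C : B} (h : Commute A C) (r : ℕ) :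
    (A + C) ^ p ^ r = A ^ p ^ r + C ^ p ^ r := by
  rcases subsingleton_or_nontrivial B with _ | _
  · exact Subsingleton.elim _ _
  · have : CharP B p := charP_of_injective_algebraMap (algebraMap k B).injective p
    have : ExpChar B p := ExpChar.prime Fact.out
    exact add_pow_expChar_pow_of_commute p r h

theorem neg_one_pow_char_pow_aux {k : Type u} [Field k] (p : ℕ) [Fact p.Prime] [CharP k p]
    (B : Type*) [Ring B] [Algebra k B] (r : ℕ) : (-1 : B) ^ p ^ r = -1 := by
  have h := add_pow_char_pow_aux (k := k) p (Commute.one_left (-1 : B)) r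
  have hp : p ^ r ≠ 0 := pow_ne_zero _ (Fact.out : p.Prime).ne_zero
  rw [add_neg_cancel, zero_pow hp, one_pow] at h
  exact eq_neg_of_add_eq_zero_right h.symm

/-- Gaussian binomial coefficients. -/
def qbinom {k : Type u} [Field k] (q : k) : ℕ → ℕ → k
  | _, 0 => 1
  | 0, _ + 1 => 0
  | m + 1, i + 1 => qbinom q m i + q ^ (i + 1) * qbinom q m (i + 1)

theorem qbinom_zero_right {k : Type u} [Field k] (q : k) (m : ℕ) : qbinom q m 0 = 1 := by
  cases m <;> rfl

theorem qbinom_gt {k : Type u} [Field k] (q : k) (m : ℕ) :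
    ∀ i, m < i → qbinom q m i = 0 := by
  induction m with
  | zero => intro i hi; obtain ⟨j, rfl⟩ := Nat.exists_eq_succ_of_ne_zero hi.ne'; rfl
  | succ m ih =>
    intro i hi
    obtain ⟨j, rfl⟩ := Nat.exists_eq_succ_of_ne_zero (by lia : i ≠ 0)
    simp only [qbinom]
    rw [ih j (by lia), ih (j + 1) (by lia)]; simp

theorem qbinom_self {k : Type u} [Field k] (q : k) (m : ℕ) : qbinom q m m = 1 := by
  induction m with
  | zero => rfl
  | succ m ih => simp only [qbinom]; rw [ih, qbinom_gt q m (m + 1) (by lia)]; simp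

theorem qbinom_mul {k : Type u} [Field k] (q : k) (m : ℕ) : ∀ i,
    qbinom q (m + 1) (i + 1) * (q ^ (i + 1) - 1) = (q ^ (m + 1) - 1) * qbinom q m i := by
  induction m with
  | zero =>
    intro i
    cases i <;> simp [qbinom]
  | succ m ih =>
    intro i
    cases i with
    | zero =>
      have h := ih 0
      have h4 : qbinom q (m + 2) 1 = qbinom q (m + 1) 0 + q ^ 1 * qbinom q (m + 1) 1 := rfl
      change qbinom q (m + 2) 1 * _ = _
      rw [h4, qbinom_zero_right]
      rw [qbinom_zero_right] at h
      linear_combination q * h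
    | succ j =>
      have h1 := ih j
      have h2 := ih (j + 1)
      have h3 : qbinom q (m + 1) (j + 1)
        = qbinom q m j + q ^ (j + 1) * qbinom q m (j + 1) := rfl
      have h4 : qbinom q (m + 2) (j + 2)
        = qbinom q (m + 1) (j + 1) + q ^ (j + 2) * qbinom q (m + 1) (j + 2) := rfl
      change qbinom q (m + 2) (j + 2) * _ = _
      rw [h4]
      linear_combination q ^ (j + 2) * h2 + q * h1 - q * (q ^ (m + 1) - 1) * h3

theorem add_pow_qcomm {k : Type u} [Field k] {B : Type*} [Ring B] [Algebra k B] {A C : B} {q : k}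
    (h : C * A = q • (A * C)) (m : ℕ) :
    (A + C) ^ m = ∑ i ∈ Finset.range (m + 1), qbinom q m i • (A ^ i * C ^ (m - i)) := by
  have hc : ∀ i : ℕ, C * A ^ i = q ^ i • (A ^ i * C) := by
    intro i
    induction i with
    | zero => simp
    | succ i ih =>
      rw [pow_succ A, ← mul_assoc, ih, smul_mul_assoc, mul_assoc, h, mul_smul_comm, smul_smul,
        ← mul_assoc, pow_succ q]
  induction m with
  | zero => simp [qbinom]
  | succ m ih =>
    rw [pow_succ', ih, add_mul, Finset.mul_sum, Finset.mul_sum]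
    have e1 : ∀ i ∈ Finset.range (m + 1), A * (qbinom q m i • (A ^ i * C ^ (m - i)))
        = qbinom q m i • (A ^ (i + 1) * C ^ (m - i)) := by
      intro i _
      rw [mul_smul_comm, ← mul_assoc, ← pow_succ']
    have e2 : ∀ i ∈ Finset.range (m + 1), C * (qbinom q m i • (A ^ i * C ^ (m - i)))
        = (q ^ i * qbinom q m i) • (A ^ i * C ^ (m + 1 - i)) := by
      intro i hi
      have hi' : m + 1 - i = (m - i) + 1 := by
        have := Finset.mem_range.1 hi
        lia
      rw [mul_smul_comm, ← mul_assoc, hc, smul_mul_assoc, mul_assoc, ← pow_succ', hi', smul_smul,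
        mul_comm]
    rw [Finset.sum_congr rfl e1, Finset.sum_congr rfl e2, Finset.sum_range_succ' _ (m + 1),
      Finset.sum_range_succ' (fun i => (q ^ i * qbinom q m i) • (A ^ i * C ^ (m + 1 - i))) m]
    have e3 : ∑ i ∈ Finset.range (m + 1),
        qbinom q (m + 1) (i + 1) • (A ^ (i + 1) * C ^ (m + 1 - (i + 1)))
        = ∑ i ∈ Finset.range (m + 1), qbinom q m i • (A ^ (i + 1) * C ^ (m - i))
        + ∑ i ∈ Finset.range m,
          (q ^ (i + 1) * qbinom q m (i + 1)) • (A ^ (i + 1) * C ^ (m + 1 - (i + 1))) := by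
      have e4 := Finset.sum_range_succ (fun i =>
        (q ^ (i + 1) * qbinom q m (i + 1)) • (A ^ (i + 1) * C ^ (m + 1 - (i + 1)))) m
      rw [qbinom_gt q m (m + 1) (by lia), mul_zero, zero_smul, add_zero] at e4
      rw [← e4, ← Finset.sum_add_distrib]
      refine Finset.sum_congr rfl fun i _ => ?_
      rw [qbinom, add_smul, Nat.add_sub_add_right]
    rw [e3, qbinom_zero_right, qbinom_zero_right]
    simp [add_assoc]

theorem add_pow_primitive {k : Type u} [Field k] {B : Type*} [Ring B] [Algebra k B] {A C : B}
    {q : k} {N : ℕ} (hN : 0 < N) (hq : IsPrimitiveRoot q N) (h : C * A = q • (A * C)) :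
    (A + C) ^ N = A ^ N + C ^ N := by
  obtain ⟨m, rfl⟩ := Nat.exists_eq_succ_of_ne_zero hN.ne'
  rw [add_pow_qcomm h, Finset.sum_range_succ, Finset.sum_range_succ', Finset.sum_eq_zero,
    qbinom_self, qbinom_zero_right]
  · simp [add_comm]
  · intro i hi
    have hi := Finset.mem_range.1 hi
    have h1 := qbinom_mul q m i
    rw [hq.pow_eq_one, sub_self, zero_mul] at h1
    have h2 : q ^ (i + 1) - 1 ≠ 0 :=
      sub_ne_zero.2 (hq.pow_ne_one_of_pos_of_lt (by lia) (by lia))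
    rw [(mul_eq_zero.1 h1).resolve_right h2, zero_smul]

/-- If `C A = q A C` with `q` a primitive `N`-th root of unity, then
`(A + C) ^ (pⁱ N) = A ^ (pⁱ N) + C ^ (pⁱ N)` in characteristic `p`. -/
theorem add_pow_qchar {k : Type u} [Field k] (p : ℕ) [Fact p.Prime] [CharP k p]
    {B : Type*} [Ring B] [Algebra k B] {A C : B}
    {q : k} {N : ℕ} (hN : 0 < N) (hq : IsPrimitiveRoot q N) (h : C * A = q • (A * C)) (i : ℕ) :
    (A + C) ^ (p ^ i * N) = A ^ (p ^ i * N) + C ^ (p ^ i * N) := by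
  have hc : ∀ i : ℕ, C * A ^ i = q ^ i • (A ^ i * C) := by
    intro i
    induction i with
    | zero => simp
    | succ i ih =>
      rw [pow_succ A, ← mul_assoc, ih, smul_mul_assoc, mul_assoc, h, mul_smul_comm, smul_smul,
        ← mul_assoc, pow_succ q]
  have hcomm : Commute (A ^ N) (C ^ N) := by
    have h1 := hc N
    rw [hq.pow_eq_one, one_smul] at h1
    exact Commute.pow_right (show Commute (A ^ N) C from h1.symm) N
  rw [mul_comm, pow_mul, pow_mul, pow_mul, add_pow_primitive hN hq h,
    add_pow_char_pow_aux (k := k) p hcomm]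

theorem neg_pow_primitive {k : Type u} [Field k] {q : k} {N : ℕ} (hN : 0 < N)
    (hq : IsPrimitiveRoot q N) : (-1) ^ N * q ^ (N * (N - 1) / 2) = -1 := by
  rcases Nat.even_or_odd' N with ⟨m, rfl | rfl⟩
  · have hm : 0 < m := by lia
    have h2 : IsPrimitiveRoot (q ^ m) 2 := hq.pow hN (by ring)
    have e : 2 * m * (2 * m - 1) / 2 = m * (2 * (m - 1) + 1) := by
      have : 2 * m - 1 = 2 * (m - 1) + 1 := by lia
      rw [this, mul_assoc, Nat.mul_div_cancel_left _ (by norm_num)]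
    rw [e, pow_mul q, h2.eq_neg_one_of_two_right, pow_mul]
    simp [pow_succ, pow_mul]
  · have e : (2 * m + 1) * (2 * m + 1 - 1) / 2 = (2 * m + 1) * m := by
      rw [Nat.add_sub_cancel, show (2 * m + 1) * (2 * m) = 2 * ((2 * m + 1) * m) by ring,
        Nat.mul_div_cancel_left _ (by norm_num)]
    rw [e, pow_mul, hq.pow_eq_one, one_pow, pow_succ, pow_mul]
    simp

theorem mul_pow_qcomm {k : Type u} [Field k] {B : Type*} [Ring B] [Algebra k B] {A C : B} {q : k}
    (h : C * A = q • (A * C)) (m : ℕ) :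
    (A * C) ^ m = q ^ (m * (m - 1) / 2) • (A ^ m * C ^ m) := by
  have hc : ∀ i : ℕ, C ^ i * A = q ^ i • (A * C ^ i) := by
    intro i
    induction i with
    | zero => simp
    | succ i ih =>
      rw [pow_succ' C, mul_assoc, ih, mul_smul_comm, ← mul_assoc, h, smul_mul_assoc, smul_smul,
        mul_assoc, pow_succ q]
  induction m with
  | zero => simp
  | succ m ih =>
    rw [pow_succ, ih, smul_mul_assoc, mul_assoc, ← mul_assoc (C ^ m), hc, smul_mul_assoc,
      mul_smul_comm, smul_smul, ← pow_add, ← Nat.triangle_succ, mul_assoc A, ← pow_succ,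
      ← mul_assoc, ← pow_succ]

/-! ### Hopf algebras given by generators and relations

One construction serves both types. -/

/-- Data for a Hopf algebra generated by a group `G` and an `(a,1)`-primitive element `x`. -/
structure Datum (k : Type u) [Field k] (p : ℕ) (G : Type v) [Group G] where
  χ : G →* kˣ
  c : G → k
  a : G
  N : ℕ
  r : ℕ
  /-- the scalar `α₋₁` -/
  αneg : k
  α : Fin r → k
  a_central : a ∈ Subgroup.center G
  N_pos : 0 < N
  prim : IsPrimitiveRoot (χ a) N
  c_a : c a = 0
  pow_a : ∀ i : Fin r, α i ≠ 0 → a ^ (N * (p ^ r - p ^ (i : ℕ))) = 1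

/-- The generators: the elements of `G` and `x`. -/
inductive Gen (G : Type v) : Type v
  | grp : G → Gen G
  | x : Gen G

namespace Datum

variable {k : Type u} [Field k] {p : ℕ} {G : Type v} [Group G]

/-- The free generator belonging to `g ∈ G`. -/
def fg (k : Type u) [Field k] {G : Type v} (g : G) : FreeAlgebra k (Gen G) :=
  FreeAlgebra.ι k (Gen.grp g)

/-- The free generator `x`. -/
def fx (k : Type u) [Field k] (G : Type v) : FreeAlgebra k (Gen G) := FreeAlgebra.ι k Gen.x

/-- The defining relations: the multiplication of `G`, `g x g⁻¹ = χ(g) x + c(g) (a - 1)` and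
`x ^ n = α₋₁ (a ^ n - 1) + ∑ i < r, αᵢ x ^ (pⁱ N)`, where `n = p ^ r N`. -/
inductive Rel (D : Datum k p G) : FreeAlgebra k (Gen G) → FreeAlgebra k (Gen G) → Prop
  | one : Rel D (fg k 1) 1
  | mul (g h : G) : Rel D (fg k (g * h)) (fg k g * fg k h)
  | conj (g : G) : Rel D (fg k g * fx k G * fg k g⁻¹)
      ((D.χ g : k) • fx k G + D.c g • (fg k D.a - 1))
  | pow : Rel D (fx k G ^ (p ^ D.r * D.N))
      (D.αneg • (fg k D.a ^ (p ^ D.r * D.N) - 1)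
        + ∑ i : Fin D.r, D.α i • fx k G ^ (p ^ (i : ℕ) * D.N))

/-- The algebra with the above generators and relations. -/
def Alg (D : Datum k p G) : Type (max u v) := RingQuot D.Rel

instance (D : Datum k p G) : Ring D.Alg := inferInstanceAs (Ring (RingQuot D.Rel))
instance (D : Datum k p G) : Algebra k D.Alg := inferInstanceAs (Algebra k (RingQuot D.Rel))

/-- The quotient map from the free algebra. -/
def proj (D : Datum k p G) : FreeAlgebra k (Gen G) →ₐ[k] D.Alg := RingQuot.mkAlgHom k D.Rel

/-- The element of the algebra given by `g ∈ G`. -/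
def grp (D : Datum k p G) (g : G) : D.Alg := D.proj (fg k g)

/-- The generator `x` of the algebra. -/
def x (D : Datum k p G) : D.Alg := D.proj (fx k G)

variable (D : Datum k p G)

theorem grp_one : D.grp 1 = 1 := by
  have := RingQuot.mkAlgHom_rel k (Rel.one (D := D))
  exact this.trans (map_one _)

theorem grp_mul (g h : G) : D.grp (g * h) = D.grp g * D.grp h := by
  have := RingQuot.mkAlgHom_rel k (Rel.mul (D := D) g h)
  exact this.trans (map_mul _ _ _)

theorem grp_conj (g : G) :
    D.grp g * D.x * D.grp g⁻¹ = (D.χ g : k) • D.x + D.c g • (D.grp D.a - 1) := by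
  have : D.proj _ = D.proj _ := RingQuot.mkAlgHom_rel k (Rel.conj (D := D) g)
  simp only [map_mul, map_add, map_sub, map_smul, map_one] at this
  exact this

theorem x_pow : D.x ^ (p ^ D.r * D.N) = D.αneg • (D.grp D.a ^ (p ^ D.r * D.N) - 1)
    + ∑ i : Fin D.r, D.α i • D.x ^ (p ^ (i : ℕ) * D.N) := by
  have : D.proj _ = D.proj _ := RingQuot.mkAlgHom_rel k (Rel.pow (D := D))
  simp only [map_pow, map_add, map_sub, map_smul, map_one, map_sum] at this
  exact this

theorem grp_pow (g : G) (n : ℕ) : D.grp (g ^ n) = D.grp g ^ n := by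
  induction n with
  | zero => simp [grp_one]
  | succ n ih => rw [pow_succ, pow_succ, grp_mul, ih]

theorem grp_mul_inv (g : G) : D.grp g * D.grp g⁻¹ = 1 := by
  rw [← grp_mul, mul_inv_cancel, grp_one]

theorem grp_inv_mul (g : G) : D.grp g⁻¹ * D.grp g = 1 := by
  rw [← grp_mul, inv_mul_cancel, grp_one]

theorem algHom_ext {B : Type*} [Semiring B] [Algebra k B] {φ ψ : D.Alg →ₐ[k] B}
    (hg : ∀ g, φ (D.grp g) = ψ (D.grp g)) (hx : φ D.x = ψ D.x) : φ = ψ := by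
  have : φ.comp D.proj = ψ.comp D.proj := by
    apply FreeAlgebra.hom_ext
    funext s
    cases s with
    | grp g => exact hg g
    | x => exact hx
  exact RingQuot.ringQuot_ext' _ _ _ this

/-- Algebra maps out of the presented algebra. -/
def lift {B : Type*} [Ring B] [Algebra k B] (f : G → B) (y : B) (h1 : f 1 = 1)
    (hmul : ∀ g h, f (g * h) = f g * f h)
    (hconj : ∀ g, f g * y * f g⁻¹ = (D.χ g : k) • y + D.c g • (f D.a - 1))
    (hpow : y ^ (p ^ D.r * D.N) = D.αneg • (f D.a ^ (p ^ D.r * D.N) - 1)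
      + ∑ i : Fin D.r, D.α i • y ^ (p ^ (i : ℕ) * D.N)) : D.Alg →ₐ[k] B :=
  RingQuot.liftAlgHom k
    ⟨FreeAlgebra.lift k (fun s => match s with | .grp g => f g | .x => y), by
      intro u v huv
      cases huv with
      | one => simpa [fg] using h1
      | mul g h => simpa [fg] using hmul g h
      | conj g => simpa [fg, fx] using hconj g
      | pow => simpa [fg, fx] using hpow⟩

section lift

variable {B : Type*} [Ring B] [Algebra k B] (f : G → B) (y : B) (h1 : f 1 = 1)
    (hmul : ∀ g h, f (g * h) = f g * f h)
    (hconj : ∀ g, f g * y * f g⁻¹ = (D.χ g : k) • y + D.c g • (f D.a - 1))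
    (hpow : y ^ (p ^ D.r * D.N) = D.αneg • (f D.a ^ (p ^ D.r * D.N) - 1)
      + ∑ i : Fin D.r, D.α i • y ^ (p ^ (i : ℕ) * D.N))

theorem lift_grp (g : G) : D.lift f y h1 hmul hconj hpow (D.grp g) = f g := by
  have := RingQuot.liftAlgHom_mkAlgHom_apply (S := k)
    (FreeAlgebra.lift k (fun s : Gen G => match s with | .grp g => f g | .x => y)) (s := D.Rel)
  exact (this _ _).trans (by simp [fg])

theorem lift_x : D.lift f y h1 hmul hconj hpow D.x = y := by
  have := RingQuot.liftAlgHom_mkAlgHom_apply (S := k)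
    (FreeAlgebra.lift k (fun s : Gen G => match s with | .grp g => f g | .x => y)) (s := D.Rel)
  exact (this _ _).trans (by simp [fx])

end lift

theorem grp_a_comm (g : G) : D.grp g * D.grp D.a = D.grp D.a * D.grp g := by
  rw [← grp_mul, ← grp_mul, Subgroup.mem_center_iff.1 D.a_central g]

theorem a_mul_x : D.grp D.a * D.x = (D.χ D.a : k) • (D.x * D.grp D.a) := by
  have h := congrArg (· * D.grp D.a) (D.grp_conj D.a)
  simpa [mul_assoc, grp_inv_mul, D.c_a] using h

theorem ainv_mul_x :
    D.grp D.a⁻¹ * D.x = ((D.χ D.a : k)⁻¹) • (D.x * D.grp D.a⁻¹) := by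
  have h := congrArg (fun t => D.grp D.a⁻¹ * t * D.grp D.a⁻¹) D.a_mul_x
  have h' : D.x * D.grp D.a⁻¹ = (D.χ D.a : k) • (D.grp D.a⁻¹ * D.x) := by
    simpa only [← mul_assoc, mul_smul_comm, smul_mul_assoc, grp_inv_mul, one_mul,
      mul_assoc _ (D.grp D.a) (D.grp D.a⁻¹), grp_mul_inv, mul_one] using h
  rw [h', smul_smul, inv_mul_cancel₀ (Units.ne_zero _), one_smul]

theorem prim_field : IsPrimitiveRoot (D.χ D.a : k) D.N :=
  IsPrimitiveRoot.coe_units_iff.2 D.prim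

theorem alpha_smul_a (i : Fin D.r) : p ≠ 0 →
    D.α i • D.grp D.a ^ (p ^ D.r * D.N) = D.α i • D.grp D.a ^ (p ^ (i : ℕ) * D.N) := by
  intro hp
  by_cases h : D.α i = 0
  · simp [h]
  · have hle : p ^ (i : ℕ) ≤ p ^ D.r := Nat.pow_le_pow_right (Nat.pos_of_ne_zero hp) i.2.le
    have e : p ^ D.r * D.N = D.N * (p ^ D.r - p ^ (i : ℕ)) + p ^ (i : ℕ) * D.N := by
      rw [mul_comm D.N, ← add_mul, Nat.sub_add_cancel hle]
    rw [← grp_pow, ← grp_pow, e, pow_add, D.pow_a i h, one_mul]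

theorem alpha_smul_ainv (i : Fin D.r) : p ≠ 0 →
    D.α i • D.grp D.a⁻¹ ^ (p ^ D.r * D.N) = D.α i • D.grp D.a⁻¹ ^ (p ^ (i : ℕ) * D.N) := by
  intro hp
  by_cases h : D.α i = 0
  · simp [h]
  · have hle : p ^ (i : ℕ) ≤ p ^ D.r := Nat.pow_le_pow_right (Nat.pos_of_ne_zero hp) i.2.le
    have e : p ^ D.r * D.N = D.N * (p ^ D.r - p ^ (i : ℕ)) + p ^ (i : ℕ) * D.N := by
      rw [mul_comm D.N, ← add_mul, Nat.sub_add_cancel hle]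
    rw [← grp_pow, ← grp_pow, e, pow_add, inv_pow _ (D.N * _), D.pow_a i h, inv_one, one_mul]

set_option linter.unusedSectionVars false

section Hopf

variable [Fact p.Prime] [CharP k p]

theorem delta_x_pow (i : ℕ) :
    (D.x ⊗ₜ[k] D.grp D.a + 1 ⊗ₜ[k] D.x) ^ (p ^ i * D.N)
      = (D.x ^ (p ^ i * D.N)) ⊗ₜ[k] (D.grp D.a ^ (p ^ i * D.N))
        + 1 ⊗ₜ[k] (D.x ^ (p ^ i * D.N)) := by
  have h : (D.x ⊗ₜ[k] D.grp D.a) * (1 ⊗ₜ[k] D.x)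
      = (D.χ D.a : k) • ((1 ⊗ₜ[k] D.x) * (D.x ⊗ₜ[k] D.grp D.a)) := by
    rw [Algebra.TensorProduct.tmul_mul_tmul, Algebra.TensorProduct.tmul_mul_tmul, mul_one,
      one_mul, a_mul_x, TensorProduct.tmul_smul]
  rw [add_comm, add_pow_qchar p D.N_pos D.prim_field h, Algebra.TensorProduct.tmul_pow,
    Algebra.TensorProduct.tmul_pow, one_pow, add_comm]

/-- The comultiplication: `Δ(g) = g ⊗ g` and `Δ(x) = x ⊗ a + 1 ⊗ x`. -/
def comulHom : D.Alg →ₐ[k] D.Alg ⊗[k] D.Alg :=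
  D.lift (fun g => D.grp g ⊗ₜ D.grp g) (D.x ⊗ₜ D.grp D.a + 1 ⊗ₜ D.x)
    (by rw [grp_one]; rfl)
    (fun g h => by rw [grp_mul, Algebra.TensorProduct.tmul_mul_tmul])
    (fun g => by
      have h : D.grp g * D.grp D.a * D.grp g⁻¹ = D.grp D.a := by
        rw [grp_a_comm, mul_assoc, grp_mul_inv, mul_one]
      simp only [mul_add, add_mul, Algebra.TensorProduct.tmul_mul_tmul, grp_conj, h, mul_one,
        grp_mul_inv, TensorProduct.add_tmul, TensorProduct.tmul_add, TensorProduct.sub_tmul,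
        TensorProduct.tmul_sub, TensorProduct.smul_tmul', TensorProduct.tmul_smul, smul_add,
        smul_sub, Algebra.TensorProduct.one_def]
      abel)
    (by
      have hp : p ≠ 0 := (Fact.out : p.Prime).ne_zero
      rw [delta_x_pow]
      simp only [delta_x_pow]
      simp only [x_pow, Algebra.TensorProduct.tmul_pow, TensorProduct.add_tmul,
        TensorProduct.tmul_add, TensorProduct.sub_tmul, TensorProduct.tmul_sub,
        TensorProduct.smul_tmul', TensorProduct.tmul_smul, smul_add, smul_sub,
        TensorProduct.sum_tmul, TensorProduct.tmul_sum, Finset.sum_add_distrib,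
        Algebra.TensorProduct.one_def]
      have h : ∀ i : Fin D.r, (D.α i • D.x ^ (p ^ (i : ℕ) * D.N)) ⊗ₜ[k]
          (D.grp D.a ^ (p ^ D.r * D.N))
          = (D.α i • D.x ^ (p ^ (i : ℕ) * D.N)) ⊗ₜ[k] (D.grp D.a ^ (p ^ (i : ℕ) * D.N)) := by
        intro i
        rw [TensorProduct.smul_tmul, alpha_smul_a _ _ hp, ← TensorProduct.smul_tmul]
      simp only [h]
      abel)

/-- The counit: `ε(g) = 1` and `ε(x) = 0`. -/
def counitHom : D.Alg →ₐ[k] k :=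
  D.lift (fun _ => 1) 0 rfl (fun _ _ => (one_mul 1).symm) (fun g => by simp)
    (by
      have hp : p ≠ 0 := (Fact.out : p.Prime).ne_zero
      have h : ∀ i : ℕ, p ^ i * D.N ≠ 0 :=
        fun i => mul_ne_zero (pow_ne_zero _ hp) D.N_pos.ne'
      simp [zero_pow (h _)])

theorem anti_x_pow (i : ℕ) :
    (-(D.x * D.grp D.a⁻¹)) ^ (p ^ i * D.N)
      = -(D.x ^ (p ^ i * D.N) * D.grp D.a⁻¹ ^ (p ^ i * D.N)) := by
  have hq := D.prim_field.inv
  have h1 : (-(D.x * D.grp D.a⁻¹)) ^ D.N = -(D.x ^ D.N * D.grp D.a⁻¹ ^ D.N) := by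
    rw [neg_pow, mul_pow_qcomm D.ainv_mul_x]
    have h := congrArg (algebraMap k D.Alg) (neg_pow_primitive D.N_pos hq)
    rw [map_mul, map_pow, map_neg, map_one] at h
    rw [Algebra.smul_def, ← mul_assoc, h, neg_one_mul]
  have hc : ∀ i : ℕ, D.grp D.a⁻¹ * D.x ^ i
      = (D.χ D.a : k)⁻¹ ^ i • (D.x ^ i * D.grp D.a⁻¹) := by
    intro i
    induction i with
    | zero => simp
    | succ i ih =>
      rw [pow_succ D.x, ← mul_assoc, ih, smul_mul_assoc, mul_assoc, ainv_mul_x, mul_smul_comm,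
        smul_smul, ← mul_assoc, pow_succ]
  have hcomm : Commute (D.x ^ D.N) (D.grp D.a⁻¹ ^ D.N) := by
    have h1 := hc D.N
    rw [hq.pow_eq_one, one_smul] at h1
    exact Commute.pow_right (show Commute (D.x ^ D.N) (D.grp D.a⁻¹) from h1.symm) D.N
  rw [mul_comm (p ^ i), pow_mul, pow_mul, pow_mul, h1, neg_pow,
    neg_one_pow_char_pow_aux (k := k) p, neg_one_mul, hcomm.mul_pow]

/-- The antipode as an algebra map to the opposite algebra: `S(g) = g⁻¹`, `S(x) = -x a⁻¹`. -/
def antipodeHom : D.Alg →ₐ[k] D.Algᵐᵒᵖ :=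
  D.lift (fun g => MulOpposite.op (D.grp g⁻¹)) (MulOpposite.op (-(D.x * D.grp D.a⁻¹)))
    (by simp [grp_one])
    (fun g h => by simp [grp_mul])
    (fun g => by
      apply MulOpposite.unop_injective
      have h1 : D.grp g * D.x = (D.χ g : k) • (D.x * D.grp g)
          + D.c g • (D.grp D.a * D.grp g - D.grp g) := by
        have := congrArg (· * D.grp g) (D.grp_conj g)
        simpa [mul_assoc, grp_inv_mul, add_mul, sub_mul] using this
      have h2 : D.grp D.a⁻¹ * D.grp g⁻¹ = D.grp g⁻¹ * D.grp D.a⁻¹ := by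
        rw [← grp_mul, ← grp_mul, ← mul_inv_rev, ← mul_inv_rev,
          Subgroup.mem_center_iff.1 D.a_central g]
      have h3 : D.grp g * D.grp D.a⁻¹ * D.grp g⁻¹ = D.grp D.a⁻¹ := by
        rw [mul_assoc, h2, ← mul_assoc, grp_mul_inv, one_mul]
      have h4 : D.grp g * (D.x * D.grp D.a⁻¹ * D.grp g⁻¹)
          = (D.χ g : k) • (D.x * D.grp D.a⁻¹) + D.c g • (1 - D.grp D.a⁻¹) := by
        rw [mul_assoc, ← mul_assoc, h1, add_mul, smul_mul_assoc, smul_mul_assoc, sub_mul,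
          mul_assoc D.x, mul_assoc (D.grp D.a), ← mul_assoc (D.grp g), h3, grp_mul_inv]
      simp only [MulOpposite.unop_mul, MulOpposite.unop_op, MulOpposite.unop_add,
        MulOpposite.unop_smul, MulOpposite.unop_sub, MulOpposite.unop_one, inv_inv]
      rw [neg_mul, mul_neg, h4]
      simp only [smul_sub, smul_neg]
      abel)
    (by
      have hp : p ≠ 0 := (Fact.out : p.Prime).ne_zero
      apply MulOpposite.unop_injective
      have hu : ∀ t : Fin D.r → D.Algᵐᵒᵖ,
          MulOpposite.unop (∑ i, t i) = ∑ i, MulOpposite.unop (t i) :=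
        fun t => map_sum (MulOpposite.opAddEquiv (α := D.Alg)).symm t Finset.univ
      simp only [MulOpposite.unop_add, MulOpposite.unop_pow, MulOpposite.unop_op,
        MulOpposite.unop_smul, MulOpposite.unop_sub, MulOpposite.unop_one, hu, anti_x_pow]
      have h : ∀ i : Fin D.r, (D.α i • D.x ^ (p ^ (i : ℕ) * D.N))
          * (D.grp D.a⁻¹ ^ (p ^ D.r * D.N))
          = D.α i • (D.x ^ (p ^ (i : ℕ) * D.N) * (D.grp D.a⁻¹ ^ (p ^ (i : ℕ) * D.N))) := by
        intro i
        rw [smul_mul_assoc, ← mul_smul_comm, alpha_smul_ainv _ _ hp, mul_smul_comm]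
      have ha : D.grp D.a ^ (p ^ D.r * D.N) * D.grp D.a⁻¹ ^ (p ^ D.r * D.N) = 1 := by
        rw [← grp_pow, ← grp_pow, inv_pow, grp_mul_inv]
      rw [x_pow, add_mul, Finset.sum_mul]
      simp only [h, smul_mul_assoc, sub_mul, ha, one_mul, smul_neg, Finset.sum_neg_distrib,
        smul_sub]
      abel)

theorem comulHom_grp (g : G) : D.comulHom (D.grp g) = D.grp g ⊗ₜ D.grp g :=
  D.lift_grp _ _ _ _ _ _ g

theorem comulHom_x : D.comulHom D.x = D.x ⊗ₜ D.grp D.a + 1 ⊗ₜ D.x :=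
  D.lift_x _ _ _ _ _ _

theorem counitHom_grp (g : G) : D.counitHom (D.grp g) = 1 :=
  D.lift_grp _ _ _ _ _ _ g

theorem counitHom_x : D.counitHom D.x = 0 :=
  D.lift_x _ _ _ _ _ _

theorem antipodeHom_grp (g : G) : D.antipodeHom (D.grp g) = MulOpposite.op (D.grp g⁻¹) :=
  D.lift_grp _ _ _ _ _ _ g

theorem antipodeHom_x : D.antipodeHom D.x = MulOpposite.op (-(D.x * D.grp D.a⁻¹)) :=
  D.lift_x _ _ _ _ _ _

instance : Bialgebra k D.Alg :=
  Bialgebra.ofAlgHom D.comulHom D.counitHom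
    (by
      apply D.algHom_ext
      · intro g; simp [comulHom_grp]
      · simp [comulHom_grp, comulHom_x, TensorProduct.add_tmul, TensorProduct.tmul_add,
          Algebra.TensorProduct.one_def, add_assoc])
    (by
      apply D.algHom_ext
      · intro g; simp [comulHom_grp, counitHom_grp]
      · simp [comulHom_x, counitHom_x])
    (by
      apply D.algHom_ext
      · intro g; simp [comulHom_grp, counitHom_grp]
      · simp [comulHom_x, counitHom_grp, counitHom_x])

theorem comul_grp (g : G) : Coalgebra.comul (R := k) (D.grp g) = D.grp g ⊗ₜ[k] D.grp g :=
  D.comulHom_grp g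

theorem comul_x : Coalgebra.comul (R := k) D.x = D.x ⊗ₜ[k] D.grp D.a + 1 ⊗ₜ[k] D.x :=
  D.comulHom_x

theorem counit_grp (g : G) : Coalgebra.counit (R := k) (D.grp g) = 1 := D.counitHom_grp g

theorem counit_x : Coalgebra.counit (R := k) D.x = 0 := D.counitHom_x

/-- The antipode as a linear map. -/
def antipodeLin : D.Alg →ₗ[k] D.Alg :=
  (MulOpposite.opLinearEquiv k).symm.toLinearMap ∘ₗ D.antipodeHom.toLinearMap

theorem antipodeLin_mul (u v : D.Alg) :
    D.antipodeLin (u * v) = D.antipodeLin v * D.antipodeLin u := by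
  simp [antipodeLin]

theorem antipodeLin_one : D.antipodeLin 1 = 1 := by simp [antipodeLin]

theorem antipodeLin_grp (g : G) : D.antipodeLin (D.grp g) = D.grp g⁻¹ := by
  simp [antipodeLin, antipodeHom_grp]

theorem antipodeLin_x : D.antipodeLin D.x = -(D.x * D.grp D.a⁻¹) := by
  simp [antipodeLin, antipodeHom_x]

theorem induction {P : D.Alg → Prop} (h0 : ∀ c : k, P (algebraMap k D.Alg c))
    (hg : ∀ g, P (D.grp g)) (hx : P D.x) (hm : ∀ u v, P u → P v → P (u * v))
    (ha : ∀ u v, P u → P v → P (u + v)) (z : D.Alg) : P z := by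
  obtain ⟨w, rfl⟩ := RingQuot.mkAlgHom_surjective k D.Rel z
  change P (D.proj w)
  induction w using FreeAlgebra.induction with
  | grade0 c => rw [AlgHom.commutes]; exact h0 c
  | grade1 s =>
    cases s with
    | grp g => exact hg g
    | x => exact hx
  | mul u v hu hv => rw [map_mul]; exact hm _ _ hu hv
  | add u v hu hv => rw [map_add]; exact ha _ _ hu hv

theorem antipode_left (z : D.Alg) :
    LinearMap.mul' k D.Alg (D.antipodeLin.rTensor D.Alg (Coalgebra.comul z))
      = algebraMap k D.Alg (Coalgebra.counit z) := by
  induction z using D.induction with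
  | h0 c =>
    rw [Algebra.algebraMap_eq_smul_one, map_smul, map_smul, map_smul, map_smul, Bialgebra.comul_one,
      Bialgebra.counit_one, Algebra.TensorProduct.one_def]
    simp [antipodeLin_one, Algebra.algebraMap_eq_smul_one]
  | hg g => simp [comul_grp, counit_grp, antipodeLin_grp, grp_inv_mul]
  | hx =>
    simp [comul_x, counit_x, antipodeLin_x, antipodeLin_one, mul_assoc, grp_inv_mul]
  | ha u v hu hv => simp only [map_add, hu, hv]
  | hm u v hu hv =>
    have key : ∀ s t : D.Alg ⊗[k] D.Alg, ∀ c : k,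
        LinearMap.mul' k D.Alg (D.antipodeLin.rTensor D.Alg s) = algebraMap k D.Alg c →
        LinearMap.mul' k D.Alg (D.antipodeLin.rTensor D.Alg (s * t))
          = c • LinearMap.mul' k D.Alg (D.antipodeLin.rTensor D.Alg t) := by
      intro s t c hs
      induction t with
      | zero => simp
      | add t t' h h' => simp only [mul_add, map_add, h, h', smul_add]
      | tmul b d =>
        have : ∀ s : D.Alg ⊗[k] D.Alg,
            LinearMap.mul' k D.Alg (D.antipodeLin.rTensor D.Alg (s * b ⊗ₜ d))
            = D.antipodeLin b * LinearMap.mul' k D.Alg (D.antipodeLin.rTensor D.Alg s) * d := by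
          intro s
          induction s with
          | zero => simp
          | add s s' h h' => simp only [add_mul, mul_add, map_add, h, h']
          | tmul e f => simp [antipodeLin_mul, mul_assoc]
        rw [this, hs]
        simp [Algebra.algebraMap_eq_smul_one]
    rw [Bialgebra.comul_mul, key _ _ _ hu, hv, Bialgebra.counit_mul, map_mul, Algebra.smul_def]

theorem antipode_right (z : D.Alg) :
    LinearMap.mul' k D.Alg (D.antipodeLin.lTensor D.Alg (Coalgebra.comul z))
      = algebraMap k D.Alg (Coalgebra.counit z) := by
  induction z using D.induction with
  | h0 c =>
    rw [Algebra.algebraMap_eq_smul_one, map_smul, map_smul, map_smul, map_smul, Bialgebra.comul_one,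
      Bialgebra.counit_one, Algebra.TensorProduct.one_def]
    simp [antipodeLin_one, Algebra.algebraMap_eq_smul_one]
  | hg g => simp [comul_grp, counit_grp, antipodeLin_grp, grp_mul_inv]
  | hx => simp [comul_x, counit_x, antipodeLin_x, antipodeLin_grp]
  | ha u v hu hv => simp only [map_add, hu, hv]
  | hm u v hu hv =>
    have key : ∀ s t : D.Alg ⊗[k] D.Alg, ∀ c : k,
        LinearMap.mul' k D.Alg (D.antipodeLin.lTensor D.Alg t) = algebraMap k D.Alg c →
        LinearMap.mul' k D.Alg (D.antipodeLin.lTensor D.Alg (s * t))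
          = c • LinearMap.mul' k D.Alg (D.antipodeLin.lTensor D.Alg s) := by
      intro s t c ht
      induction s with
      | zero => simp
      | add s s' h h' => simp only [add_mul, map_add, h, h', smul_add]
      | tmul b d =>
        have : ∀ t : D.Alg ⊗[k] D.Alg,
            LinearMap.mul' k D.Alg (D.antipodeLin.lTensor D.Alg (b ⊗ₜ d * t))
            = b * LinearMap.mul' k D.Alg (D.antipodeLin.lTensor D.Alg t) * D.antipodeLin d := by
          intro t
          induction t with
          | zero => simp
          | add t t' h h' => simp only [add_mul, mul_add, map_add, h, h']
          | tmul e f => simp [antipodeLin_mul, mul_assoc]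
        rw [this, ht]
        simp [Algebra.algebraMap_eq_smul_one]
    rw [Bialgebra.comul_mul, key _ _ _ hv, hu, Bialgebra.counit_mul, mul_comm, map_mul,
      Algebra.smul_def]

instance : HopfAlgebra k D.Alg where
  antipode := D.antipodeLin
  mul_antipode_rTensor_comul := LinearMap.ext D.antipode_left
  mul_antipode_lTensor_comul := LinearMap.ext D.antipode_right

theorem antipode_grp (g : G) : HopfAlgebra.antipode k (D.grp g) = D.grp g⁻¹ := D.antipodeLin_grp g

theorem antipode_x : HopfAlgebra.antipode k D.x = -(D.x * D.grp D.a⁻¹) := D.antipodeLin_x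

end Hopf

/-- The elements `g xⁱ` with `g ∈ G` and `0 ≤ i ≤ n - 1`, where `n = p ^ r N`. -/
def monomial (t : G × Fin (p ^ D.r * D.N)) : D.Alg := D.grp t.1 * D.x ^ (t.2 : ℕ)

/-- The elements `g xⁱ` with `g ∈ G` and `0 ≤ i ≤ n - 1` form a `k`-basis. -/
def MonomialsFormBasis : Prop :=
  LinearIndependent k D.monomial ∧ Submodule.span k (Set.range D.monomial) = ⊤

end Datum

/-! ### The two types of tuples -/

/-- Tuples `R = (G, χ, a, (α₋₁, α₀, …, α_{r-1}))` of the first type. Here `N = orderOf (χ a)` is the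
order of `χ(a)` as a root of unity and `n = p ^ r N`. -/
structure FirstType (k : Type u) [Field k] (p : ℕ) (G : Type v) [Group G] where
  χ : G →* kˣ
  a : G
  r : ℕ
  /-- the scalar `α₋₁` -/
  αneg : k
  α : Fin r → k
  a_central : a ∈ Subgroup.center G
  χ_a : χ a ≠ 1
  αneg_eq_zero : a ^ (p ^ r * orderOf (χ a)) = 1 → αneg = 0
  pow_a : ∀ i : Fin r, α i ≠ 0 → a ^ (orderOf (χ a) * (p ^ r - p ^ (i : ℕ))) = 1
  pow_χ : ∀ i : Fin r, α i ≠ 0 → ∀ g, χ g ^ (orderOf (χ a) * (p ^ r - p ^ (i : ℕ))) = 1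
  pow_χ_neg : αneg ≠ 0 → ∀ g, χ g ^ (orderOf (χ a) * p ^ r) = 1

/-- Tuples `F = (G, χ, c, a, (α₋₁, α₀))` of the second type. -/
structure SecondType (k : Type u) [Field k] (p : ℕ) (G : Type v) [Group G] where
  χ : G →* kˣ
  c : G → k
  a : G
  /-- the scalar `α₋₁` -/
  αneg : k
  /-- the scalar `α₀` -/
  α : k
  a_central : a ∈ Subgroup.center G
  χ_a : χ a = 1
  c_mul : ∀ h g, c (h * g) = (χ g : k) * c h + c g
  c_a : c a = 0
  α_zero_or_one : α = 0 ∨ α = 1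
  αneg_eq_zero : α = 0 → αneg = 0
  of_zero : α = 0 → ∀ g,
    c g • (MonoidAlgebra.of k G (a ^ p) - 1 : MonoidAlgebra k G) = 0
  pow_a : α = 1 → a ^ p = a
  /-- `χ(g)` lies in the prime field. -/
  χ_prime : α = 1 → ∀ g, (χ g : k) ∈ (⊥ : Subfield k)
  of_one : α = 1 → ∀ g, (αneg * ((χ g : k) - 1) + c g ^ p - c g) •
    (MonoidAlgebra.of k G a - 1 : MonoidAlgebra k G) = 0

namespace FirstType

variable {k : Type u} [Field k] {p : ℕ} {G : Type v} [Group G] [Finite G]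

/-- The relations of `H_R` are `g x g⁻¹ = χ(g) x` and
`x ^ n = α₋₁ (a ^ n - 1) + ∑ i < r, αᵢ x ^ (pⁱ N)`. -/
def toDatum (R : FirstType k p G) : Datum k p G where
  χ := R.χ
  c := fun _ => 0
  a := R.a
  N := orderOf (R.χ R.a)
  r := R.r
  αneg := R.αneg
  α := R.α
  a_central := R.a_central
  N_pos := orderOf_pos_iff.2 (R.χ.isOfFinOrder (isOfFinOrder_of_finite R.a))
  prim := IsPrimitiveRoot.orderOf _
  c_a := rfl
  pow_a := R.pow_a

/-- The Hopf algebra `H_R`. -/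
abbrev HR (R : FirstType k p G) : Type (max u v) := R.toDatum.Alg

theorem conj (R : FirstType k p G) (g : G) :
    R.toDatum.grp g * R.toDatum.x * R.toDatum.grp g⁻¹ = (R.χ g : k) • R.toDatum.x :=
  (R.toDatum.grp_conj g).trans (by
    rw [show R.toDatum.c g = 0 from rfl, zero_smul, add_zero]
    rfl)

end FirstType

namespace SecondType

variable {k : Type u} [Field k] {p : ℕ} {G : Type v} [Group G]

/-- The relations of `H_F` are `g x g⁻¹ = χ(g) x + c(g) (a - 1)` and
`x ^ p = α₋₁ (a ^ p - 1) + α₀ x`; this is the case `N = 1`, `r = 1` of the general construction. -/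
def toDatum [Fact p.Prime] (F : SecondType k p G) : Datum k p G where
  χ := F.χ
  c := F.c
  a := F.a
  N := 1
  r := 1
  αneg := F.αneg
  α := fun _ => F.α
  a_central := F.a_central
  N_pos := Nat.one_pos
  prim := by rw [F.χ_a]; exact IsPrimitiveRoot.one
  c_a := F.c_a
  pow_a := fun i hi => by
    have hp : 1 ≤ p := (Fact.out : p.Prime).one_le
    have h := F.pow_a (F.α_zero_or_one.resolve_left hi)
    have h2 : F.a ^ (p - 1) * F.a = 1 * F.a := by
      rw [← pow_succ, Nat.sub_add_cancel hp, h, one_mul]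
    simpa [Fin.eq_zero i] using mul_right_cancel h2

/-- The Hopf algebra `H_F`. -/
abbrev HF [Fact p.Prime] (F : SecondType k p G) : Type (max u v) := F.toDatum.Alg

theorem conj [Fact p.Prime] (F : SecondType k p G) (g : G) :
    F.toDatum.grp g * F.toDatum.x * F.toDatum.grp g⁻¹
      = (F.χ g : k) • F.toDatum.x + F.c g • (F.toDatum.grp F.a - 1) :=
  F.toDatum.grp_conj g

theorem x_pow [Fact p.Prime] (F : SecondType k p G) :
    F.toDatum.x ^ p = F.αneg • (F.toDatum.grp F.a ^ p - 1) + F.α • F.toDatum.x := by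
  have h := F.toDatum.x_pow
  change F.toDatum.x ^ (p ^ 1 * 1) = F.αneg • (F.toDatum.grp F.a ^ (p ^ 1 * 1) - 1)
    + ∑ i : Fin 1, F.α • F.toDatum.x ^ (p ^ (i : ℕ) * 1) at h
  simpa only [pow_one, mul_one, Fin.sum_univ_one, Fin.val_zero, pow_zero] using h

end SecondType

end RankOne

end

/-!
Let `G` be the group of group-like elements of `H`; by pointedness it spans `H₀`.

For `m ∈ H₁`, the comultiplication is `∑ g, g ⊗ m_g` modulo `H ⊗ H₀`, and coassociativity makes
each `m_g` homogeneous, `Δ(m_g) ≡ g ⊗ m_g`; moreover `m ≡ ∑ g, m_g` modulo `H₀`. Thus `H₁ / H₀` is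
graded by `G`, and the map `m ↦ ∑ g, g⁻¹ m_g` into `H / H₀` is `H₀`-invariant
(`exists_invariant_map`). Together with the counit it is defined on `k ⊗_{H₀} H₁`, which has
dimension two. This leaves a single homogeneous direction in each degree: an element of left
degree `g` lies in `k g x + H₀` (`exists_sub_smul_mem_coradical`). So `H₁ = H₀ + H₀ x`, and a
`(b,1)`-primitive element is of the form `β x + γ (b - 1)`, with `b = a` if `β ≠ 0`
(`skewPrimitive_eq`).

This applies to the skew primitive elements `g x g⁻¹`, which gives the centrality of `a`, the
character `χ` and the cocycle `c` (`exists_character`), and to `x ^ n`, where `n` is the order `N`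
of `q` if `q ≠ 1` and `n = p` if `q = 1`; for these exponents the mixed terms of `Δ(x) ^ n`
vanish. If `q ≠ 1`, centrality of `a` forces `c = 0`, and conjugation by `a` forces `x ^ N ∈ H₀`.
If `q = 1`, then `x ^ p = β x + γ (a ^ p - 1)`, and over an algebraically closed field a
translation or a rescaling of `x` normalizes `β` and `γ`. Conjugating the formula for `x ^ n` by
`g` yields the conditions on the tuple.

It remains to see that the presented Hopf algebra is not larger than `H`. The monomials
`g xⁱ`, `i < n`, span the former (`Datum.span_monomial`) and are linearly independent in `H`
(`linearIndependent_monomials`), because the `q`-integers `1, …, n - 1` are nonzero in `k`. So the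
surjection onto `H` given by the relations is an isomorphism.
-/

noncomputable section

namespace RankOne

/-! ### The coradical of a pointed coalgebra -/

/-- A linearly independent family has a dual family of linear functionals. -/
theorem exists_dual_family {k : Type*} {V ι : Type*} [Field k] [AddCommGroup V] [Module k V]
    [DecidableEq ι] {v : ι → V} (hv : LinearIndependent k v) :
    ∃ E : ι → V →ₗ[k] k, ∀ i j, E i (v j) = if i = j then 1 else 0 := by
  obtain ⟨f, hf⟩ := (Finsupp.linearCombination k v).exists_leftInverse_of_injective
    (LinearMap.ker_eq_bot.2 hv)
  refine ⟨fun i => Finsupp.lapply i ∘ₗ f, fun i j => ?_⟩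
  have := LinearMap.congr_fun hf (Finsupp.single j 1)
  rw [LinearMap.comp_apply, Finsupp.linearCombination_single, one_smul] at this
  simp [this, Finsupp.single_apply, eq_comm]

section Coalgebra

variable {k : Type u} {H : Type v} [Field k] [AddCommGroup H] [Module k H]

theorem tmul_mem_tensorSub {U V : Submodule k H} {s t : H} (hs : s ∈ U) (ht : t ∈ V) :
    s ⊗ₜ[k] t ∈ tensorSub k U V :=
  ⟨(⟨s, hs⟩ : U) ⊗ₜ (⟨t, ht⟩ : V), rfl⟩

/-- To put the image of `U ⊗ V` under a linear map into a submodule, it suffices to consider pure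
tensors. -/
theorem tensorSub_le_comap {U V : Submodule k H} {M : Type*} [AddCommGroup M] [Module k M]
    (f : H ⊗[k] H →ₗ[k] M) (S : Submodule k M)
    (h : ∀ s ∈ U, ∀ t ∈ V, f (s ⊗ₜ t) ∈ S) : tensorSub k U V ≤ S.comap f := by
  rintro _ ⟨z, rfl⟩
  induction z with
  | zero => simp
  | add z w hz hw => rw [map_add]; exact add_mem hz hw
  | tmul s t => exact h s s.2 t t.2

variable [Coalgebra k H]

theorem isSimpleSubcoalgebra_span_groupLike (g : GroupLike k H) :
    IsSimpleSubcoalgebra k (k ∙ (g : H)) := by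
  have hg : (g : H) ≠ 0 := g.2.ne_zero
  refine ⟨fun d hd => ?_, (nonzero_span_atom _ hg).1,
    fun E _ hE => (nonzero_span_atom _ hg).le_iff.1 hE⟩
  obtain ⟨c, rfl⟩ := Submodule.mem_span_singleton.1 hd
  rw [map_smul, g.2.comul_eq_tmul_self]
  exact Submodule.smul_mem _ _ (tmul_mem_tensorSub (Submodule.mem_span_singleton_self _)
    (Submodule.mem_span_singleton_self _))

/-- A one-dimensional subcoalgebra is spanned by a group-like element. -/
theorem IsSubcoalgebra.exists_eq_span_groupLike {D : Submodule k H} (hD : IsSubcoalgebra k D)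
    (h1 : Module.finrank k D = 1) : ∃ g : GroupLike k H, D = k ∙ (g : H) := by
  obtain ⟨⟨d, hd⟩, hd0, hspan⟩ := finrank_eq_one_iff'.1 h1
  have hspan' : ∀ w ∈ D, ∃ c : k, c • d = w := fun w hw => by
    obtain ⟨c, hc⟩ := hspan ⟨w, hw⟩
    exact ⟨c, congrArg Subtype.val hc⟩
  have hle : tensorSub k D D ≤ (k ∙ (d ⊗ₜ[k] d)).comap LinearMap.id := by
    apply tensorSub_le_comap
    intro s hs t ht
    obtain ⟨b, rfl⟩ := hspan' s hs
    obtain ⟨c, rfl⟩ := hspan' t ht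
    rw [LinearMap.id_apply, TensorProduct.smul_tmul_smul]
    exact Submodule.smul_mem _ _ (Submodule.mem_span_singleton_self _)
  obtain ⟨c, hc⟩ := Submodule.mem_span_singleton.1 (hle (hD d hd))
  replace hc : c • d ⊗ₜ[k] d = Coalgebra.comul (R := k) d := hc
  have hd0' : d ≠ 0 := fun h => hd0 (Subtype.ext h)
  have hcd : c * Coalgebra.counit (R := k) d = 1 := by
    have h := Coalgebra.rTensor_counit_comul (R := k) d
    rw [← hc, map_smul, LinearMap.rTensor_tmul] at h
    have h' := congrArg (TensorProduct.lid k H) h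
    rw [map_smul, TensorProduct.lid_tmul, TensorProduct.lid_tmul, one_smul, smul_smul] at h'
    exact (smul_left_injective k hd0') (by simpa using h')
  have hc0 : c ≠ 0 := left_ne_zero_of_mul_eq_one hcd
  refine ⟨⟨c • d, by simpa using hcd, ?_⟩, le_antisymm (fun w hw => ?_) ?_⟩
  · rw [map_smul, ← hc, TensorProduct.smul_tmul_smul, smul_smul]
  · obtain ⟨b, rfl⟩ := hspan' w hw
    exact Submodule.mem_span_singleton.2 ⟨b * c⁻¹, by
      rw [smul_smul, mul_assoc, inv_mul_cancel₀ hc0, mul_one]⟩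
  · exact (Submodule.span_singleton_le_iff_mem _ _).2 (D.smul_mem c hd)

theorem groupLike_mem_coradical (g : GroupLike k H) : (g : H) ∈ coradical k H := by
  have h : (k ∙ (g : H)) ≤ coradical k H :=
    le_sSup (show (k ∙ (g : H)) ∈ {D | IsSimpleSubcoalgebra k D} from
      isSimpleSubcoalgebra_span_groupLike g)
  exact h (Submodule.mem_span_singleton_self _)

theorem coradical_eq_span_groupLike (hp : IsPointed k H) :
    coradical k H = Submodule.span k (Set.range (GroupLike.val (R := k) (A := H))) := by
  apply le_antisymm
  · refine sSup_le fun D hD => ?_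
    obtain ⟨g, rfl⟩ := hD.1.exists_eq_span_groupLike (hp D hD)
    exact Submodule.span_mono (Set.singleton_subset_iff.2 ⟨g, rfl⟩)
  · rw [Submodule.span_le]
    rintro _ ⟨g, rfl⟩
    exact groupLike_mem_coradical g

/-! ### Left homogeneous components -/

/-- The operator `u ↦ (φ ⊗ id) Δ(u)`. For `φ` dual to a group-like element `g`, it is the projection
of `H₁` modulo `H₀` onto the part of left degree `g`. -/
def leftSlice (φ : H →ₗ[k] k) : H →ₗ[k] H :=
  TensorProduct.lid k H ∘ₗ φ.rTensor H ∘ₗ Coalgebra.comul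

theorem leftSlice_of_comul {φ : H →ₗ[k] k} {u : H} {t : H ⊗[k] H}
    (h : Coalgebra.comul (R := k) u = t) :
    leftSlice φ u = TensorProduct.lid k H (φ.rTensor H t) := by
  rw [← h]; rfl

theorem leftSlice_groupLike (φ : H →ₗ[k] k) (g : GroupLike k H) :
    leftSlice φ (g : H) = φ g • (g : H) := by
  rw [leftSlice_of_comul g.2.comul_eq_tmul_self]; simp

/-- Coassociativity, for slices. -/
theorem comul_leftSlice (φ : H →ₗ[k] k) (u : H) :
    Coalgebra.comul (R := k) (leftSlice φ u) = (leftSlice φ).rTensor H (Coalgebra.comul u) := by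
  have key : ∀ t : H ⊗[k] H, Coalgebra.comul (R := k) (TensorProduct.lid k H (φ.rTensor H t))
      = TensorProduct.lid k (H ⊗[k] H) (φ.rTensor (H ⊗[k] H) (Coalgebra.comul.lTensor H t)) := by
    intro t
    induction t with
    | zero => simp
    | add s t hs ht => simp only [map_add, hs, ht]
    | tmul s t => simp
  have key2 : ∀ t : (H ⊗[k] H) ⊗[k] H, TensorProduct.lid k (H ⊗[k] H) (φ.rTensor (H ⊗[k] H)
      (TensorProduct.assoc k H H H t))
      = (TensorProduct.lid k H ∘ₗ φ.rTensor H).rTensor H t := by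
    intro t
    induction t with
    | zero => simp
    | add s t hs ht => simp only [map_add, hs, ht]
    | tmul s t =>
      induction s with
      | zero => simp
      | add s t hs ht => simp only [map_add, TensorProduct.add_tmul, hs, ht]
      | tmul s r => simp [TensorProduct.smul_tmul']
  change Coalgebra.comul (R := k) (TensorProduct.lid k H (φ.rTensor H (Coalgebra.comul u))) = _
  rw [key, ← Coalgebra.coassoc_apply, key2, ← LinearMap.comp_apply, ← LinearMap.rTensor_comp]
  rfl

variable {E : GroupLike k H → H →ₗ[k] k} [Fintype (GroupLike k H)] [DecidableEq (GroupLike k H)]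

/-- Modulo `H ⊗ H₀`, the comultiplication of `m ∈ H₁` is `∑ g, g ⊗ m_g`, where
`m_g` is the slice of `m` by the functional dual to `g`. -/
theorem comul_sub_sum_mem
    (hE : ∀ g h : GroupLike k H, E g (h : H) = if g = h then 1 else 0) (hp : IsPointed k H) {m : H}
    (hm : m ∈ coradicalFiltration k H 1) :
    Coalgebra.comul (R := k) m - ∑ g : GroupLike k H, (g : H) ⊗ₜ[k] leftSlice (E g) m
      ∈ tensorSub k ⊤ (coradical k H) := by
  let P : H ⊗[k] H →ₗ[k] H ⊗[k] H := LinearMap.id - ∑ g : GroupLike k H,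
    TensorProduct.mk k H H (g : H) ∘ₗ (TensorProduct.lid k H).toLinearMap ∘ₗ (E g).rTensor H
  have hP : ∀ t, P t = t - ∑ g : GroupLike k H,
      (g : H) ⊗ₜ[k] TensorProduct.lid k H ((E g).rTensor H t) := fun t => by simp [P]
  have h1 : tensorSub k ⊤ (coradical k H) ≤ (tensorSub k ⊤ (coradical k H)).comap P := by
    apply tensorSub_le_comap
    intro s _ t ht
    rw [hP]
    refine sub_mem (tmul_mem_tensorSub trivial ht) (sum_mem fun g _ => ?_)
    exact tmul_mem_tensorSub trivial (by simpa using Submodule.smul_mem _ _ ht)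
  have h2 : tensorSub k (coradical k H) ⊤ ≤ (tensorSub k ⊤ (coradical k H)).comap P := by
    apply tensorSub_le_comap
    intro s hs t _
    suffices h : P (s ⊗ₜ t) = 0 by rw [h]; exact zero_mem _
    rw [coradical_eq_span_groupLike hp] at hs
    induction hs using Submodule.span_induction with
    | zero => simp
    | add s r _ _ h h' => rw [TensorProduct.add_tmul, map_add, h, h', add_zero]
    | smul c s _ h => rw [← TensorProduct.smul_tmul', map_smul, h, smul_zero]
    | mem s hs =>
      obtain ⟨g, rfl⟩ := hs
      simp [hP, hE, ite_smul, TensorProduct.tmul_ite]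
  have := (sup_le h1 h2 : _ ≤ _) (show Coalgebra.comul (R := k) m ∈ _ from hm)
  rwa [Submodule.mem_comap, hP] at this

theorem sub_sum_leftSlice_mem
    (hE : ∀ g h : GroupLike k H, E g (h : H) = if g = h then 1 else 0) (hp : IsPointed k H) {m : H}
    (hm : m ∈ coradicalFiltration k H 1) :
    m - ∑ g, leftSlice (E g) m ∈ coradical k H := by
  have h1 : tensorSub k ⊤ (coradical k H) ≤ (coradical k H).comap
      ((TensorProduct.lid k H).toLinearMap ∘ₗ Coalgebra.counit.rTensor H) := by
    apply tensorSub_le_comap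
    intro s _ t ht
    simpa using Submodule.smul_mem _ _ ht
  have := h1 (comul_sub_sum_mem hE hp hm)
  simpa [Coalgebra.rTensor_counit_comul] using this

/-- The component `m_g` of an element of `H₁` is homogeneous of left degree `g` modulo `H₀`. -/
theorem comul_leftSlice_sub_mem
    (hE : ∀ g h : GroupLike k H, E g (h : H) = if g = h then 1 else 0) (hp : IsPointed k H) {m : H}
    (hm : m ∈ coradicalFiltration k H 1) (g : GroupLike k H) :
    Coalgebra.comul (R := k) (leftSlice (E g) m) - (g : H) ⊗ₜ[k] leftSlice (E g) m
      ∈ tensorSub k ⊤ (coradical k H) := by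
  have h1 : tensorSub k ⊤ (coradical k H) ≤ (tensorSub k ⊤ (coradical k H)).comap
      ((leftSlice (E g)).rTensor H) := by
    apply tensorSub_le_comap
    intro s _ t ht
    exact tmul_mem_tensorSub trivial ht
  have := h1 (comul_sub_sum_mem hE hp hm)
  simpa [← comul_leftSlice, leftSlice_groupLike, hE, ite_smul, TensorProduct.ite_tmul] using this

end Coalgebra

/-! ### The first term of the coradical filtration in rank one -/

section Hopf

variable {k : Type u} {H : Type v} [Field k] [Ring H] [HopfAlgebra k H]

theorem GroupLike.mul_inv_val (g : GroupLike k H) : (g : H) * ((g⁻¹ : GroupLike k H) : H) = 1 := by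
  rw [← GroupLike.val_mul, mul_inv_cancel, GroupLike.val_one]

theorem GroupLike.inv_mul_val (g : GroupLike k H) : ((g⁻¹ : GroupLike k H) : H) * (g : H) = 1 := by
  rw [← GroupLike.val_mul, inv_mul_cancel, GroupLike.val_one]

theorem mul_mem_coradical (hp : IsPointed k H) {s t : H} (hs : s ∈ coradical k H)
    (ht : t ∈ coradical k H) : s * t ∈ coradical k H := by
  rw [coradical_eq_span_groupLike hp] at *
  have := Submodule.mul_mem_mul hs ht
  rw [Submodule.span_mul_span] at this
  refine Submodule.span_mono ?_ this
  rintro _ ⟨_, ⟨g, rfl⟩, _, ⟨h, rfl⟩, rfl⟩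
  exact ⟨g * h, rfl⟩

theorem one_mem_coradical : (1 : H) ∈ coradical k H :=
  groupLike_mem_coradical (1 : GroupLike k H)

theorem mem_filtration_one_of_comul_sub_mem {y : H} {g : GroupLike k H}
    (hy : Coalgebra.comul (R := k) y - (g : H) ⊗ₜ[k] y ∈ tensorSub k ⊤ (coradical k H)) :
    y ∈ coradicalFiltration k H 1 := by
  change Coalgebra.comul (R := k) y ∈
    tensorSub k ⊤ (coradical k H) ⊔ tensorSub k (coradical k H) ⊤
  rw [← sub_add_cancel (Coalgebra.comul (R := k) y) ((g : H) ⊗ₜ[k] y)]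
  exact Submodule.add_mem_sup hy (tmul_mem_tensorSub (groupLike_mem_coradical g) trivial)

theorem comul_sub_mem_of_skewPrimitive {y : H} {g h : GroupLike k H}
    (hy : y ∈ skewPrimitives k g h) :
    Coalgebra.comul (R := k) y - (h : H) ⊗ₜ[k] y ∈ tensorSub k ⊤ (coradical k H) := by
  rw [show Coalgebra.comul (R := k) y = _ from hy, add_sub_cancel_right]
  exact tmul_mem_tensorSub trivial (groupLike_mem_coradical g)

theorem counit_skewPrimitive {b : GroupLike k H} {y : H} (hy : y ∈ skewPrimitives k b 1) :
    Coalgebra.counit (R := k) y = 0 := by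
  have h := Coalgebra.rTensor_counit_comul (R := k) y
  rw [show Coalgebra.comul (R := k) y = _ from hy] at h
  have h' := congrArg (TensorProduct.lid k H) h
  have h2 := congrArg (Coalgebra.counit (R := k)) h'
  simpa using h2

variable [FiniteDimensional k H]

instance finite_groupLike : Finite (GroupLike k H) :=
  (linearIndep_groupLikeVal (R := k) (A := H)).finite

/-- A linear map into `H / H₀` that moves every homogeneous component of an element of `H₁` into left
degree `1`. On `H₁` it is `H₀`-invariant, and hence factors through `k ⊗_{H₀} H₁`. -/
theorem exists_invariant_map (hp : IsPointed k H) :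
    ∃ F : H →ₗ[k] H ⧸ coradical k H,
      (∀ (y : H) (g : GroupLike k H),
        Coalgebra.comul (R := k) y - (g : H) ⊗ₜ[k] y ∈ tensorSub k ⊤ (coradical k H) →
        F y = (coradical k H).mkQ (((g⁻¹ : GroupLike k H) : H) * y)) ∧
      ∀ m ∈ coradicalFiltration k H 1, ∀ h ∈ coradical k H,
        F (h * m) = Coalgebra.counit (R := k) h • F m := by
  classical
  have := Fintype.ofFinite (GroupLike k H)
  obtain ⟨E, hE⟩ := exists_dual_family (linearIndep_groupLikeVal (R := k) (A := H))
  let T : H ⊗[k] H →ₗ[k] H ⧸ coradical k H := ∑ g : GroupLike k H,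
    (coradical k H).mkQ ∘ₗ LinearMap.mulLeft k ((g⁻¹ : GroupLike k H) : H) ∘ₗ
      (TensorProduct.lid k H).toLinearMap ∘ₗ (E g).rTensor H
  have hT : ∀ s t, T (s ⊗ₜ t) = ∑ g : GroupLike k H,
      E g s • (coradical k H).mkQ (((g⁻¹ : GroupLike k H) : H) * t) := by
    intro s t
    simp only [T, LinearMap.sum_apply, LinearMap.comp_apply, LinearMap.rTensor_tmul,
      LinearEquiv.coe_coe, TensorProduct.lid_tmul, map_smul, LinearMap.mulLeft_apply]
  have hTg : ∀ (g : GroupLike k H) (t : H),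
      T ((g : H) ⊗ₜ t) = (coradical k H).mkQ (((g⁻¹ : GroupLike k H) : H) * t) := by
    intro g t
    simp only [hT, hE, ite_smul, one_smul, zero_smul, Finset.sum_ite_eq', Finset.mem_univ, if_true]
  have hT0' : ∀ s, ∀ t ∈ coradical k H, T (s ⊗ₜ t) = 0 := by
    intro s t ht
    rw [hT]
    refine Finset.sum_eq_zero fun g _ => ?_
    rw [Submodule.mkQ_apply, (Submodule.Quotient.mk_eq_zero _).2
      (mul_mem_coradical hp (groupLike_mem_coradical _) ht), smul_zero]
  have hT0 : ∀ t ∈ tensorSub k ⊤ (coradical k H), T t = 0 :=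
    tensorSub_le_comap T ⊥ fun s _ t ht => hT0' s t ht
  have hinv : ∀ (h : GroupLike k H),
      ∀ t ∈ tensorSub k ⊤ (coradical k H) ⊔ tensorSub k (coradical k H) ⊤,
        T (((h : H) ⊗ₜ[k] (h : H)) * t) = T t := by
    intro h
    let U : H ⊗[k] H →ₗ[k] H ⧸ coradical k H :=
      T ∘ₗ LinearMap.mulLeft k ((h : H) ⊗ₜ[k] (h : H)) - T
    have hU : ∀ s t, U (s ⊗ₜ t) = T (((h : H) * s) ⊗ₜ ((h : H) * t)) - T (s ⊗ₜ t) := by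
      intro s t
      simp [U]
    have h1 : tensorSub k ⊤ (coradical k H) ≤ (⊥ : Submodule k _).comap U :=
      tensorSub_le_comap U ⊥ fun s _ t ht => by
        rw [Submodule.mem_bot, hU, hT0' _ _ ht,
          hT0' _ _ (mul_mem_coradical hp (groupLike_mem_coradical h) ht), sub_zero]
    have h2 : tensorSub k (coradical k H) ⊤ ≤ (⊥ : Submodule k _).comap U :=
      tensorSub_le_comap U ⊥ fun s hs t _ => by
        rw [coradical_eq_span_groupLike hp] at hs
        rw [Submodule.mem_bot]
        induction hs using Submodule.span_induction with
        | zero => simp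
        | add s r _ _ h h' => rw [TensorProduct.add_tmul, map_add, h, h', add_zero]
        | smul c s _ h => rw [← TensorProduct.smul_tmul', map_smul, h, smul_zero]
        | mem s hs =>
          obtain ⟨g, rfl⟩ := hs
          rw [hU, ← GroupLike.val_mul, hTg, hTg, ← mul_assoc, ← GroupLike.val_mul, mul_inv_rev,
            inv_mul_cancel_right, sub_self]
    intro t ht
    have := sup_le h1 h2 ht
    exact sub_eq_zero.1 this
  refine ⟨T ∘ₗ Coalgebra.comul, fun y g hy => ?_, fun m hm h hh => ?_⟩
  · have := hT0 _ hy
    rw [map_sub, sub_eq_zero, hTg] at this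
    exact this
  · rw [coradical_eq_span_groupLike hp] at hh
    induction hh using Submodule.span_induction with
    | zero => simp
    | add s r _ _ h h' => rw [add_mul, map_add, h, h', map_add, add_smul]
    | smul c s _ h => rw [smul_mul_assoc, map_smul, h, map_smul, smul_smul, smul_eq_mul]
    | mem s hs =>
      obtain ⟨g, rfl⟩ := hs
      rw [LinearMap.comp_apply, Bialgebra.comul_mul, g.2.comul_eq_tmul_self, hinv g _ hm,
        g.2.counit_eq_one, one_smul]
      rfl

variable {a : GroupLike k H} {x : H}

/-- In rank one, `H₁ / H₀` has, up to scalars, only one element of left degree `g`: the dimension of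
`k ⊗_{H₀} H₁` leaves no room for more. -/
theorem exists_sub_smul_mem_coradical (hp : IsPointed k H) (hr : HasRank k H 1)
    (hx : x ∈ skewPrimitives k a 1) (hx0 : x ∉ coradical k H) {y : H} {g : GroupLike k H}
    (hy : Coalgebra.comul (R := k) y - (g : H) ⊗ₜ[k] y ∈ tensorSub k ⊤ (coradical k H)) :
    ∃ β : k, y - β • ((g : H) * x) ∈ coradical k H := by
  obtain ⟨F, hF, hinv⟩ := exists_invariant_map hp
  let Ψ : coradicalFiltration k H 1 →ₗ[k] k × (H ⧸ coradical k H) :=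
    ((Coalgebra.counit (R := k)).prod F) ∘ₗ (coradicalFiltration k H 1).subtype
  let Φ : k ⊗[k] coradicalFiltration k H 1 →ₗ[k] k × (H ⧸ coradical k H) :=
    Ψ ∘ₗ (TensorProduct.lid k _).toLinearMap
  have hbal : balancedRelations k H ≤ LinearMap.ker Φ := by
    refine Submodule.span_le.2 ?_
    rintro _ ⟨s, h, m, m', hh, hm', rfl⟩
    have h1 : Ψ m' = Coalgebra.counit (R := k) h • Ψ m := by
      apply Prod.ext
      · simp [Ψ, hm']
      · change F m' = Coalgebra.counit (R := k) h • F m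
        rw [hm', hinv m m.2 h hh]
    rw [SetLike.mem_coe, LinearMap.mem_ker]
    simp [Φ, h1, mul_smul]
  let x1 : coradicalFiltration k H 1 :=
    ⟨x, mem_filtration_one_of_comul_sub_mem (comul_sub_mem_of_skewPrimitive hx)⟩
  let y1 : coradicalFiltration k H 1 := ⟨y, mem_filtration_one_of_comul_sub_mem hy⟩
  let e : coradicalFiltration k H 1 := ⟨1, mem_filtration_one_of_comul_sub_mem (g := 1) (by
    rw [Bialgebra.comul_one, GroupLike.val_one, Algebra.TensorProduct.one_def, sub_self]
    exact zero_mem _)⟩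
  have hfin : Module.finrank k ((k ⊗[k] coradicalFiltration k H 1) ⧸ balancedRelations k H) = 2 :=
    hr
  have : Module.Finite k ((k ⊗[k] coradicalFiltration k H 1) ⧸ balancedRelations k H) :=
    Module.finite_of_finrank_pos (by lia)
  let v : Fin 3 → (k ⊗[k] coradicalFiltration k H 1) ⧸ balancedRelations k H :=
    fun i => (balancedRelations k H).mkQ (1 ⊗ₜ ![e, x1, y1] i)
  have hdep : ¬ LinearIndependent k v := fun h => by
    have := h.fintype_card_le_finrank
    rw [hfin, Fintype.card_fin] at this
    lia
  obtain ⟨s, hs, j, hj⟩ := Fintype.not_linearIndependent_iff.1 hdep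
  have hmap := congrArg ((balancedRelations k H).liftQ Φ hbal) hs
  have hΨ : s 0 • Ψ e + s 1 • Ψ x1 + s 2 • Ψ y1 = 0 := by
    simpa [Fin.sum_univ_three, v, Φ] using hmap
  have hFe : F 1 = 0 := by
    rw [hF 1 1 (by
      rw [Bialgebra.comul_one, GroupLike.val_one, Algebra.TensorProduct.one_def, sub_self]
      exact zero_mem _), Submodule.mkQ_apply, Submodule.Quotient.mk_eq_zero, mul_one]
    exact groupLike_mem_coradical _
  have hFx : F x = (coradical k H).mkQ x := by
    rw [hF x 1 (comul_sub_mem_of_skewPrimitive hx), inv_one, GroupLike.val_one, one_mul]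
  have h1 : s 0 + s 2 * Coalgebra.counit (R := k) y = 0 := by
    simpa [Ψ, e, x1, y1, counit_skewPrimitive hx] using congrArg Prod.fst hΨ
  have h2 : s 1 • F x + s 2 • F y = 0 := by
    simpa [Ψ, e, x1, y1, hFe] using congrArg Prod.snd hΨ
  rw [hFx, hF y g hy, ← map_smul, ← map_smul, ← map_add, Submodule.mkQ_apply,
    Submodule.Quotient.mk_eq_zero] at h2
  by_cases h20 : s 2 = 0
  · exfalso
    rw [h20, zero_mul, add_zero] at h1
    rw [h20, zero_smul, add_zero] at h2
    have h10 : s 1 = 0 := by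
      by_contra h10
      exact hx0 (((coradical k H).smul_mem_iff h10).1 h2)
    fin_cases j <;> contradiction
  · refine ⟨-((s 2)⁻¹ * s 1), ?_⟩
    have h3 := mul_mem_coradical hp (groupLike_mem_coradical g)
      ((coradical k H).smul_mem (s 2)⁻¹ h2)
    rwa [smul_add, smul_smul, smul_smul, inv_mul_cancel₀ h20, one_smul, mul_add, mul_smul_comm,
      ← mul_assoc, GroupLike.mul_inv_val, one_mul, add_comm, ← sub_neg_eq_add, ← neg_smul] at h3

/-- `H₁ = H₀ + H₀ x`. -/
theorem filtration_one_le_span (hp : IsPointed k H) (hr : HasRank k H 1)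
    (hx : x ∈ skewPrimitives k a 1) (hx0 : x ∉ coradical k H) :
    coradicalFiltration k H 1 ≤
      coradical k H ⊔ Submodule.span k (Set.range fun g : GroupLike k H => (g : H) * x) := by
  classical
  have := Fintype.ofFinite (GroupLike k H)
  obtain ⟨E, hE⟩ := exists_dual_family (linearIndep_groupLikeVal (R := k) (A := H))
  intro m hm
  rw [← sub_add_cancel m (∑ g, leftSlice (E g) m)]
  refine add_mem (Submodule.mem_sup_left (sub_sum_leftSlice_mem hE hp hm))
    (sum_mem fun g _ => ?_)
  obtain ⟨β, hβ⟩ := exists_sub_smul_mem_coradical hp hr hx hx0 (comul_leftSlice_sub_mem hE hp hm g)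
  rw [← sub_add_cancel (leftSlice (E g) m) (β • ((g : H) * x))]
  exact Submodule.add_mem_sup hβ (Submodule.smul_mem _ _ (Submodule.subset_span ⟨g, rfl⟩))

/-! ### Skew primitive elements in rank one -/

theorem skewPrimitive_of_mem_coradical (hp : IsPointed k H) {b : GroupLike k H} {y : H}
    (hy : y ∈ skewPrimitives k b 1) (hy0 : y ∈ coradical k H) :
    ∃ γ : k, y = γ • ((b : H) - 1) := by
  classical
  have := Fintype.ofFinite (GroupLike k H)
  obtain ⟨E, hE⟩ := exists_dual_family (linearIndep_groupLikeVal (R := k) (A := H))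
  rw [coradical_eq_span_groupLike hp] at hy0
  obtain ⟨c, rfl⟩ := (Submodule.mem_span_range_iff_exists_fun k).1 hy0
  have key : ∀ g : GroupLike k H, c g • (g : H)
      = c g • (b : H) + if g = 1 then ∑ i, c i • (i : H) else 0 := by
    intro g
    -- Apply `E g` to the left tensor factor of `Δ(y) = y ⊗ b + 1 ⊗ y`.
    have h := congrArg (fun t => TensorProduct.lid k H ((E g).rTensor H t))
      (show Coalgebra.comul (R := k) _ = _ from hy)
    simpa [TensorProduct.sum_tmul, TensorProduct.tmul_sum, hE,
      ← GroupLike.val_one (R := k) (A := H), ← TensorProduct.smul_tmul', ite_smul,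
      Finset.smul_sum, Finset.sum_ite_eq,
      -GroupLike.val_one] using h
  refine ⟨-c 1, ?_⟩
  have h := key 1
  rw [if_pos rfl, GroupLike.val_one] at h
  rw [neg_smul, smul_sub, neg_sub, h, add_sub_cancel_left]

/-- Every `(b,1)`-primitive element is a combination of `x` and `b - 1`, and `x` occurs only if
`b = a`. -/
theorem skewPrimitive_eq (hp : IsPointed k H) (hr : HasRank k H 1)
    (hx : x ∈ skewPrimitives k a 1) (hx0 : x ∉ coradical k H) {b : GroupLike k H} {y : H}
    (hy : y ∈ skewPrimitives k b 1) :
    ∃ β γ : k, y = β • x + γ • ((b : H) - 1) ∧ (β ≠ 0 → b = a) := by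
  obtain ⟨β, hβ⟩ := exists_sub_smul_mem_coradical hp hr hx hx0
    (comul_sub_mem_of_skewPrimitive hy)
  rw [GroupLike.val_one, one_mul] at hβ
  have hβa : β ≠ 0 → b = a := by
    intro hβ0
    -- The right degree of an element is detected by slicing with a functional that kills `H₀`.
    obtain ⟨f, hfx, hf⟩ := Submodule.exists_le_ker_of_notMem hx0
    have hfg : ∀ g : GroupLike k H, f (g : H) = 0 := fun g => hf (groupLike_mem_coradical g)
    have hslice : ∀ (c : GroupLike k H) (z : H), z ∈ skewPrimitives k c 1 →
        leftSlice f z = f z • (c : H) := by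
      intro c z hz
      rw [leftSlice_of_comul hz, map_add, LinearMap.rTensor_tmul, LinearMap.rTensor_tmul, hfg,
        TensorProduct.zero_tmul, add_zero, TensorProduct.lid_tmul]
    have hslice0 : ∀ h ∈ coradical k H, leftSlice f h = 0 := by
      intro h hh
      rw [coradical_eq_span_groupLike hp] at hh
      refine (Submodule.span_le (p := LinearMap.ker (leftSlice f))).2 ?_ hh
      rintro _ ⟨g, rfl⟩
      rw [SetLike.mem_coe, LinearMap.mem_ker, leftSlice_groupLike, hfg, zero_smul]
    have h1 := hslice0 _ hβ
    have h2 : f y = β * f x := by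
      have := LinearMap.mem_ker.1 (hf hβ)
      rwa [map_sub, map_smul, sub_eq_zero] at this
    rw [map_sub, map_smul, hslice b y hy, hslice a x hx, h2, smul_smul, ← smul_sub] at h1
    exact GroupLike.val_injective
      (sub_eq_zero.1 ((smul_eq_zero.1 h1).resolve_left (mul_ne_zero hβ0 hfx)))
  by_cases h0 : β = 0
  · rw [h0, zero_smul, sub_zero] at hβ
    obtain ⟨γ, hγ⟩ := skewPrimitive_of_mem_coradical hp hy hβ
    exact ⟨0, γ, by rw [zero_smul, zero_add, hγ], fun h => (h rfl).elim⟩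
  · obtain rfl := hβa h0
    have hz : y - β • x ∈ skewPrimitives k b 1 := by
      change Coalgebra.comul (R := k) _ = _
      rw [map_sub, map_smul, show Coalgebra.comul (R := k) y = _ from hy,
        show Coalgebra.comul (R := k) x = _ from hx, TensorProduct.sub_tmul, TensorProduct.tmul_sub,
        smul_add, TensorProduct.smul_tmul', TensorProduct.tmul_smul]
      abel
    obtain ⟨γ, hγ⟩ := skewPrimitive_of_mem_coradical hp hz hβ
    exact ⟨β, γ, by rw [← hγ, add_sub_cancel], fun _ => rfl⟩

end Hopf

/-! ### Linear independence of the monomials -/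

section Hopf

variable {k : Type u} {H : Type v} [Field k] [Ring H] [HopfAlgebra k H]
  {a : GroupLike k H} {x : H} {q : k}

theorem one_tmul_qcomm (hax : (a : H) * x = q • (x * (a : H))) :
    (x ⊗ₜ[k] (a : H)) * ((1 : H) ⊗ₜ[k] x)
      = q • (((1 : H) ⊗ₜ[k] x) * (x ⊗ₜ[k] (a : H))) := by
  rw [Algebra.TensorProduct.tmul_mul_tmul, Algebra.TensorProduct.tmul_mul_tmul, mul_one, one_mul,
    hax, TensorProduct.tmul_smul]

theorem leftSlice_monomial (hx : x ∈ skewPrimitives k a 1)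
    (hax : (a : H) * x = q • (x * (a : H))) (f : H →ₗ[k] k) (g : GroupLike k H) (l : ℕ) :
    leftSlice f ((g : H) * x ^ l) = ∑ i ∈ Finset.range (l + 1),
      (qbinom q l i * f ((g : H) * x ^ (l - i))) • ((g : H) * (x ^ i * (a : H) ^ (l - i))) := by
  have h : Coalgebra.comul (R := k) x = (1 : H) ⊗ₜ[k] x + x ⊗ₜ[k] (a : H) := by
    rw [add_comm]; exact hx
  have hΔ : Coalgebra.comul (R := k) ((g : H) * x ^ l) = ∑ i ∈ Finset.range (l + 1),
      qbinom q l i • (((g : H) * x ^ (l - i)) ⊗ₜ[k] ((g : H) * (x ^ i * (a : H) ^ (l - i)))) := by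
    rw [Bialgebra.comul_mul, Bialgebra.comul_pow, h, add_pow_qcomm (one_tmul_qcomm hax),
      g.2.comul_eq_tmul_self, Finset.mul_sum]
    refine Finset.sum_congr rfl fun i _ => ?_
    rw [mul_smul_comm, Algebra.TensorProduct.tmul_pow, Algebra.TensorProduct.tmul_pow, one_pow,
      Algebra.TensorProduct.tmul_mul_tmul, Algebra.TensorProduct.tmul_mul_tmul, one_mul]
  rw [leftSlice_of_comul hΔ, map_sum, map_sum]
  refine Finset.sum_congr rfl fun i _ => ?_
  rw [map_smul, map_smul, LinearMap.rTensor_tmul, TensorProduct.lid_tmul, smul_smul]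

theorem groupLike_mul_pow_mem (a g : GroupLike k H) (l : ℕ) :
    (g : H) * (a : H) ^ l ∈ coradical k H :=
  groupLike_mem_coradical (g * a ^ l)

theorem leftSlice_monomial_mem (hx : x ∈ skewPrimitives k a 1)
    (hax : (a : H) * x = q • (x * (a : H))) {f : H →ₗ[k] k} {g : GroupLike k H} {l m : ℕ}
    (hlm : l ≤ m) (hf : ∀ j < m, f ((g : H) * x ^ j) = 0) :
    leftSlice f ((g : H) * x ^ l) ∈ coradical k H := by
  rw [leftSlice_monomial hx hax, Finset.sum_range_succ']
  refine add_mem (sum_mem fun i hi => ?_) (Submodule.smul_mem _ _ ?_)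
  · have := Finset.mem_range.1 hi
    rw [hf _ (by lia), mul_zero, zero_smul]
    exact zero_mem _
  · rw [pow_zero, one_mul]
    exact groupLike_mul_pow_mem a g _

theorem leftSlice_monomial_succ_sub_mem (hx : x ∈ skewPrimitives k a 1)
    (hax : (a : H) * x = q • (x * (a : H))) {f : H →ₗ[k] k} {g : GroupLike k H} {m : ℕ}
    (hf : ∀ j < m, f ((g : H) * x ^ j) = 0) :
    leftSlice f ((g : H) * x ^ (m + 1)) - (qbinom q (m + 1) 1 * f ((g : H) * x ^ m)) •
      ((g : H) * (x * (a : H) ^ m)) ∈ coradical k H := by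
  rw [leftSlice_monomial hx hax, Finset.sum_range_succ', Finset.sum_range_succ']
  simp only [zero_add, pow_one, Nat.add_sub_cancel]
  rw [add_right_comm, add_sub_cancel_right]
  refine add_mem (sum_mem fun i hi => ?_) (Submodule.smul_mem _ _ ?_)
  · have := Finset.mem_range.1 hi
    rw [hf _ (by lia), mul_zero, zero_smul]
    exact zero_mem _
  · rw [pow_zero, one_mul]
    exact groupLike_mul_pow_mem a g _

/-- The elements `g xⁱ` with `i < n` are linearly independent as long as the `q`-integers below `n`
do not vanish. In a linear relation with top degree `m + 1`, the slice by the functional dual to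
`g xᵐ` is, modulo `H₀`, the coefficient of `g xᵐ⁺¹` times `(m + 1)_q g x aᵐ`. -/
theorem linearIndependent_monomials [FiniteDimensional k H] (hp : IsPointed k H)
    (hx : x ∈ skewPrimitives k a 1) (hx0 : x ∉ coradical k H)
    (hax : (a : H) * x = q • (x * (a : H))) (n : ℕ)
    (hn : ∀ m, m + 1 < n → qbinom q (m + 1) 1 ≠ 0) :
    LinearIndependent k
      (fun t : GroupLike k H × Fin n => (t.1 : H) * x ^ (t.2 : ℕ)) := by
  classical
  have := Fintype.ofFinite (GroupLike k H)
  induction n with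
  | zero => exact linearIndependent_empty_type
  | succ n ih =>
    have ih := ih fun m hm => hn m (by lia)
    rw [Fintype.linearIndependent_iff]
    intro c hc
    rw [Fintype.sum_prod_type] at hc
    simp only [Fin.sum_univ_castSucc, Fin.val_castSucc, Fin.val_last] at hc
    have htop : ∀ g, c (g, Fin.last n) = 0 := by
      cases n with
      | zero =>
        refine Fintype.linearIndependent_iff.1 (linearIndep_groupLikeVal (R := k) (A := H))
          (fun g => c (g, Fin.last 0)) ?_
        simpa using hc
      | succ m =>
        intro g
        obtain ⟨E, hE⟩ := exists_dual_family ih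
        let f := E (g, Fin.last m)
        have hf : ∀ h : GroupLike k H, ∀ j < m, f ((h : H) * x ^ j) = 0 := by
          intro h j hj
          have := hE (g, Fin.last m) (h, ⟨j, by lia⟩)
          rwa [if_neg (by simp [Fin.ext_iff]; lia)] at this
        have hfm : ∀ h : GroupLike k H, f ((h : H) * x ^ m) = if g = h then 1 else 0 := by
          intro h
          have := hE (g, Fin.last m) (h, Fin.last m)
          simpa using this
        have hs := congrArg (leftSlice f) hc
        simp only [map_sum, map_add, map_smul, map_zero] at hs
        have hmem : ∑ h : GroupLike k H, (∑ i : Fin (m + 1), c (h, i.castSucc) •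
              leftSlice f ((h : H) * x ^ (i : ℕ)) + c (h, Fin.last (m + 1)) •
            (leftSlice f ((h : H) * x ^ (m + 1)) - (qbinom q (m + 1) 1 * f ((h : H) * x ^ m)) •
              ((h : H) * (x * (a : H) ^ m)))) ∈ coradical k H :=
          sum_mem fun h _ => add_mem (sum_mem fun i _ => Submodule.smul_mem _ _
            (leftSlice_monomial_mem hx hax (by lia) (hf h)))
            (Submodule.smul_mem _ _ (leftSlice_monomial_succ_sub_mem hx hax (hf h)))
        simp only [smul_sub, add_sub_assoc', Finset.sum_sub_distrib] at hmem
        rw [hs, zero_sub] at hmem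
        have hmem := neg_mem hmem
        simp only [hfm, neg_neg, mul_ite, mul_one, mul_zero, ite_smul, zero_smul, smul_ite,
          smul_zero, Finset.sum_ite_eq, Finset.mem_univ, if_true, smul_smul] at hmem
        by_contra hc0
        have h1 := ((coradical k H).smul_mem_iff
          (mul_ne_zero hc0 (hn m (by lia)))).1 hmem
        have h2 := mul_mem_coradical hp (mul_mem_coradical hp
          (groupLike_mem_coradical g⁻¹) h1) (groupLike_mem_coradical (a ^ m)⁻¹)
        rw [← mul_assoc, GroupLike.inv_mul_val, one_mul, mul_assoc, ← GroupLike.val_pow,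
          GroupLike.mul_inv_val, mul_one] at h2
        exact hx0 h2
    simp only [htop, zero_smul, add_zero] at hc
    rw [← Fintype.sum_prod_type (fun t : GroupLike k H × Fin n =>
      c (t.1, t.2.castSucc) • ((t.1 : H) * x ^ (t.2 : ℕ)))] at hc
    have hlow := Fintype.linearIndependent_iff.1 ih _ hc
    rintro ⟨g, i⟩
    induction i using Fin.lastCases with
    | last => exact htop g
    | cast i => exact hlow (g, i)

end Hopf

/-! ### Recognition of the presented Hopf algebras -/

namespace Datum

section

variable {k : Type u} [Field k] {p : ℕ} {G : Type v} [Group G] (D : Datum k p G)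

theorem x_mul_grp (g : G) :
    D.x * D.grp g = (D.χ g⁻¹ : k) • (D.grp g * D.x)
      + D.c g⁻¹ • (D.grp (g * D.a) - D.grp g) := by
  have h := congrArg (D.grp g * ·) (D.grp_conj g⁻¹)
  simpa [← mul_assoc, grp_mul_inv, mul_add, mul_sub, grp_mul] using h

theorem grp_mul_pow_mem_span [Fact p.Prime] (g : G) {j : ℕ} (hj : j ≤ p ^ D.r * D.N) :
    D.grp g * D.x ^ j ∈ Submodule.span k (Set.range D.monomial) := by
  have hlt : ∀ (g : G) (j : ℕ), j < p ^ D.r * D.N →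
      D.grp g * D.x ^ j ∈ Submodule.span k (Set.range D.monomial) :=
    fun g j h => Submodule.subset_span ⟨(g, ⟨j, h⟩), rfl⟩
  have hp := (Fact.out : p.Prime)
  have hpos : 0 < p ^ D.r * D.N := Nat.mul_pos (pow_pos hp.pos _) D.N_pos
  rcases hj.lt_or_eq with h | rfl
  · exact hlt g j h
  · rw [x_pow, mul_add, mul_smul_comm, mul_sub, ← grp_pow, ← grp_mul, mul_one, Finset.mul_sum]
    refine add_mem (Submodule.smul_mem _ _ (sub_mem ?_ ?_)) (sum_mem fun i _ => ?_)
    · simpa using hlt (g * D.a ^ (p ^ D.r * D.N)) 0 hpos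
    · simpa using hlt g 0 hpos
    · rw [mul_smul_comm]
      exact Submodule.smul_mem _ _ (hlt _ _ (Nat.mul_lt_mul_of_pos_right
        (Nat.pow_lt_pow_right hp.one_lt i.2) D.N_pos))

/-- The span of the monomials is a left ideal containing `1`. -/
theorem span_monomial [Fact p.Prime] [CharP k p] : Submodule.span k (Set.range D.monomial) = ⊤ := by
  have key : ∀ z : D.Alg, ∀ s ∈ Submodule.span k (Set.range D.monomial),
      z * s ∈ Submodule.span k (Set.range D.monomial) := by
    have hmon : ∀ z, (∀ t, z * D.monomial t ∈ Submodule.span k (Set.range D.monomial)) →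
        ∀ s ∈ Submodule.span k (Set.range D.monomial),
          z * s ∈ Submodule.span k (Set.range D.monomial) := by
      intro z h s hs
      refine (Submodule.span_le
        (p := (Submodule.span k (Set.range D.monomial)).comap (LinearMap.mulLeft k z))).2 ?_ hs
      rintro _ ⟨t, rfl⟩
      exact h t
    intro z
    induction z using D.induction with
    | h0 c =>
      intro s hs
      rw [← Algebra.smul_def]
      exact Submodule.smul_mem _ _ hs
    | hg g =>
      refine hmon _ fun t => ?_
      rw [monomial, ← mul_assoc, ← grp_mul]
      exact D.grp_mul_pow_mem_span _ t.2.2.le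
    | hx =>
      refine hmon _ fun t => ?_
      rw [monomial, ← mul_assoc, x_mul_grp, add_mul, smul_mul_assoc, smul_mul_assoc, sub_mul,
        mul_assoc, ← pow_succ']
      exact add_mem (Submodule.smul_mem _ _ (D.grp_mul_pow_mem_span _ t.2.2))
        (Submodule.smul_mem _ _ (sub_mem (D.grp_mul_pow_mem_span _ t.2.2.le)
          (D.grp_mul_pow_mem_span _ t.2.2.le)))
    | hm u v hu hv => intro s hs; rw [mul_assoc]; exact hu _ (hv _ hs)
    | ha u v hu hv => intro s hs; rw [add_mul]; exact add_mem (hu _ hs) (hv _ hs)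
  refine eq_top_iff.2 fun z _ => ?_
  have h1 : (1 : D.Alg) ∈ Submodule.span k (Set.range D.monomial) := by
    simpa [grp_one] using D.grp_mul_pow_mem_span 1 (Nat.zero_le _)
  simpa using key z 1 h1

end

variable {k : Type u} [Field k] {p : ℕ} [Fact p.Prime] [CharP k p]
  {H : Type v} [Ring H] [HopfAlgebra k H] (D : Datum k p (GroupLike k H))

/-- A Hopf algebra generated by its group-like elements and an element `x` that satisfy the defining
relations is isomorphic to the presented Hopf algebra if the monomials `g xⁱ` are independent. -/
theorem monomialsFormBasis_and_nonempty_equiv {x : H} (hx : x ∈ skewPrimitives k D.a 1)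
    (hconj : ∀ g : GroupLike k H, (g : H) * x * ((g⁻¹ : GroupLike k H) : H)
      = (D.χ g : k) • x + D.c g • ((D.a : H) - 1))
    (hpow : x ^ (p ^ D.r * D.N) = D.αneg • ((D.a : H) ^ (p ^ D.r * D.N) - 1)
      + ∑ i : Fin D.r, D.α i • x ^ (p ^ (i : ℕ) * D.N))
    (hli : LinearIndependent k
      (fun t : GroupLike k H × Fin (p ^ D.r * D.N) => (t.1 : H) * x ^ (t.2 : ℕ)))
    (hgen : Algebra.adjoin k (insert x (Set.range (GroupLike.val (R := k) (A := H)))) = ⊤) :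
    D.MonomialsFormBasis ∧ Nonempty (H ≃ₐc[k] D.Alg) := by
  let φ : D.Alg →ₐ[k] H := D.lift GroupLike.val x rfl (fun _ _ => rfl) hconj hpow
  have hφg : ∀ g, φ (D.grp g) = (g : H) := D.lift_grp _ _ _ _ _ _
  have hφx : φ D.x = x := D.lift_x _ _ _ _ _ _
  have hφm : ∀ t, φ (D.monomial t) = (t.1 : H) * x ^ (t.2 : ℕ) := fun t => by
    rw [monomial, map_mul, map_pow, hφg, hφx]
  have hli' : LinearIndependent k (φ.toLinearMap ∘ D.monomial) := by
    convert hli using 1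
    exact funext hφm
  refine ⟨⟨hli'.of_comp _, D.span_monomial⟩, ?_⟩
  let ψ : D.Alg →ₐc[k] H := BialgHom.ofAlgHom φ
    (by
      apply D.algHom_ext
      · intro g
        simp [hφg, counit_grp]
      · simp [hφx, counit_x, counit_skewPrimitive hx])
    (by
      apply D.algHom_ext
      · intro g
        simp [hφg, comul_grp]
      · simp [hφx, hφg, comul_x, show Coalgebra.comul (R := k) x = _ from hx])
  have hinj : Function.Injective φ := by
    rw [injective_iff_map_eq_zero]
    intro z hz
    have hz' : z ∈ Submodule.span k (Set.range D.monomial) := D.span_monomial ▸ trivial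
    obtain ⟨c, rfl⟩ := Finsupp.mem_span_range_iff_exists_finsupp.1 hz'
    have h0 : Finsupp.linearCombination k (φ.toLinearMap ∘ D.monomial) c = 0 := by
      rw [← hz, Finsupp.linearCombination_apply, map_finsuppSum]
      simp
    rw [linearIndependent_iff.1 hli' c h0, Finsupp.sum_zero_index]
  have hsurj : Function.Surjective φ := by
    rw [← AlgHom.range_eq_top, eq_top_iff, ← hgen, Algebra.adjoin_le_iff]
    rintro _ (rfl | ⟨g, rfl⟩)
    · exact ⟨D.x, hφx⟩
    · exact ⟨D.grp g, hφg g⟩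
  exact ⟨(BialgEquiv.ofBijective ψ ⟨hinj, hsurj⟩).symm⟩

end Datum

/-! ### Conjugation and powers of the skew primitive element -/

section Hopf

variable {k : Type u} {H : Type v} [Field k] [Ring H] [HopfAlgebra k H]
  {a : GroupLike k H} {x : H}

/-- The coefficients of `x` and of `a - 1` are determined by the element. -/
theorem coeff_unique (hx0 : x ∉ coradical k H) {β γ β' γ' : k}
    (h : β • x + γ • ((a : H) - 1) = β' • x + γ' • ((a : H) - 1)) :
    β = β' ∧ γ • ((a : H) - 1) = γ' • ((a : H) - 1) := by
  have hmem : (β - β') • x ∈ coradical k H := by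
    have : (β - β') • x = (γ' - γ) • ((a : H) - 1) := by
      rw [sub_smul, sub_smul, sub_eq_sub_iff_add_eq_add, h]; abel
    rw [this]
    exact Submodule.smul_mem _ _ (sub_mem (groupLike_mem_coradical a) one_mem_coradical)
  have hβ : β = β' := by
    by_contra hne
    exact hx0 (((coradical k H).smul_mem_iff (sub_ne_zero.2 hne)).1 hmem)
  subst hβ
  exact ⟨rfl, add_left_cancel h⟩

theorem groupLike_sub_one_ne_zero {b : GroupLike k H} (hb : b ≠ 1) : (b : H) - 1 ≠ 0 := by
  rw [← GroupLike.val_one (R := k)]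
  exact sub_ne_zero.2 fun h => hb (GroupLike.val_injective h)

theorem conj_conj (h g : GroupLike k H) (y : H) :
    ((h * g : GroupLike k H) : H) * y * (((h * g)⁻¹ : GroupLike k H) : H)
      = (h : H) * ((g : H) * y * ((g⁻¹ : GroupLike k H) : H)) * ((h⁻¹ : GroupLike k H) : H) := by
  rw [mul_inv_rev, GroupLike.val_mul, GroupLike.val_mul]
  simp only [mul_assoc]

theorem conj_npow (g : GroupLike k H) (y : H) (n : ℕ) :
    ((g : H) * y * ((g⁻¹ : GroupLike k H) : H)) ^ n
      = (g : H) * y ^ n * ((g⁻¹ : GroupLike k H) : H) :=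
  Units.conj_pow (GroupLike.toUnits k g) y n

theorem conj_groupLike (g b : GroupLike k H) :
    (g : H) * b * ((g⁻¹ : GroupLike k H) : H) = ((g * b * g⁻¹ : GroupLike k H) : H) := rfl

theorem conj_sub_one {g b : GroupLike k H} (hb : g * b * g⁻¹ = b) :
    (g : H) * ((b : H) - 1) * ((g⁻¹ : GroupLike k H) : H) = (b : H) - 1 := by
  rw [mul_sub, sub_mul, conj_groupLike, hb, mul_one, GroupLike.mul_inv_val]

theorem conj_mem_skewPrimitives {b : GroupLike k H} (hx : x ∈ skewPrimitives k b 1)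
    (g : GroupLike k H) : (g : H) * x * ((g⁻¹ : GroupLike k H) : H)
      ∈ skewPrimitives k (g * b * g⁻¹) 1 := by
  change Coalgebra.comul (R := k) _ = _
  rw [Bialgebra.comul_mul, Bialgebra.comul_mul, g.2.comul_eq_tmul_self,
    (g⁻¹).2.comul_eq_tmul_self, show Coalgebra.comul (R := k) x = _ from hx, mul_add, add_mul]
  simp only [Algebra.TensorProduct.tmul_mul_tmul, ← GroupLike.val_mul, mul_one, mul_inv_cancel]

theorem pow_mem_skewPrimitives (p : ℕ) [Fact p.Prime] [CharP k p]
    (hx : x ∈ skewPrimitives k a 1) {q : k} (hax : (a : H) * x = q • (x * (a : H)))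
    {N : ℕ} (hN : 0 < N) (hq : IsPrimitiveRoot q N) (i : ℕ) :
    x ^ (p ^ i * N) ∈ skewPrimitives k (a ^ (p ^ i * N)) 1 := by
  have h : Coalgebra.comul (R := k) x = (1 : H) ⊗ₜ[k] x + x ⊗ₜ[k] (a : H) := by
    rw [add_comm]; exact hx
  change Coalgebra.comul (R := k) _ = _
  rw [Bialgebra.comul_pow, h, add_pow_qchar p hN hq (one_tmul_qcomm hax),
    Algebra.TensorProduct.tmul_pow, Algebra.TensorProduct.tmul_pow, one_pow, add_comm]
  rfl

theorem groupLike_mul_of_conj {q : k}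
    (hq : (a : H) * x * ((a⁻¹ : GroupLike k H) : H) = q • x) :
    (a : H) * x = q • (x * (a : H)) := by
  rw [← smul_mul_assoc, ← hq, mul_assoc, GroupLike.inv_mul_val, mul_one]

variable [FiniteDimensional k H]

/-- Conjugation on `x` is given by a character `χ` and a cocycle `c`, and `a` is central. If `a = 1`
then `c` is not determined by the conjugation, and the choice is `c = 0`. -/
theorem exists_character (hp : IsPointed k H) (hr : HasRank k H 1)
    (hx : x ∈ skewPrimitives k a 1) (hx0 : x ∉ coradical k H) {q : k}
    (hq : (a : H) * x * ((a⁻¹ : GroupLike k H) : H) = q • x) :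
    ∃ (χ : GroupLike k H →* kˣ) (c : GroupLike k H → k),
      a ∈ Subgroup.center (GroupLike k H) ∧ (χ a : k) = q ∧ c a = 0 ∧
      (∀ h g, c (h * g) = (χ g : k) * c h + c g) ∧
      ∀ g : GroupLike k H, (g : H) * x * ((g⁻¹ : GroupLike k H) : H)
        = (χ g : k) • x + c g • ((a : H) - 1) := by
  classical
  have hex : ∀ g : GroupLike k H, ∃ β γ : k, g * a * g⁻¹ = a ∧
      (g : H) * x * ((g⁻¹ : GroupLike k H) : H) = β • x + γ • ((a : H) - 1) := by
    intro g
    obtain ⟨β, γ, h, hβ⟩ := skewPrimitive_eq hp hr hx hx0 (conj_mem_skewPrimitives hx g)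
    have hβ0 : β ≠ 0 := by
      rintro rfl
      have h1 : (g : H) * x * ((g⁻¹ : GroupLike k H) : H) ∈ coradical k H := by
        rw [h, zero_smul, zero_add]
        exact Submodule.smul_mem _ _ (sub_mem (groupLike_mem_coradical _) one_mem_coradical)
      have h2 := mul_mem_coradical hp
        (mul_mem_coradical hp (groupLike_mem_coradical g⁻¹) h1) (groupLike_mem_coradical g)
      simp only [mul_assoc, GroupLike.inv_mul_val, mul_one] at h2
      rw [← mul_assoc, GroupLike.inv_mul_val, one_mul] at h2
      exact hx0 h2
    exact ⟨β, γ, hβ hβ0, by rw [h, hβ hβ0]⟩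
  choose β γ' hcent hβγ' using hex
  let γ : GroupLike k H → k := fun g => if a = 1 then 0 else γ' g
  have hγ : ∀ g, γ g • ((a : H) - 1) = γ' g • ((a : H) - 1) := by
    intro g
    by_cases ha : a = 1
    · rw [ha, GroupLike.val_one, sub_self, smul_zero, smul_zero]
    · simp only [γ, if_neg ha]
  have hβγ : ∀ g : GroupLike k H, (g : H) * x * ((g⁻¹ : GroupLike k H) : H)
      = β g • x + γ g • ((a : H) - 1) := fun g => by rw [hγ, hβγ']
  have hγ_ext : ∀ {g : GroupLike k H} {s : k}, (a = 1 → s = 0) →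
      γ g • ((a : H) - 1) = s • ((a : H) - 1) → γ g = s := by
    intro g s hs h
    by_cases ha : a = 1
    · simp only [γ, if_pos ha, hs ha]
    · exact smul_left_injective k (groupLike_sub_one_ne_zero ha) h
  have hγ1 : a = 1 → ∀ g, γ g = 0 := fun ha g => by simp only [γ, if_pos ha]
  have hmul : ∀ h g, β (h * g) = β h * β g ∧ γ (h * g) = β g * γ h + γ g := by
    intro h g
    have h1 := conj_conj h g x
    rw [hβγ, hβγ g, mul_add, add_mul, mul_smul_comm, smul_mul_assoc, hβγ h, mul_smul_comm,
      smul_mul_assoc, conj_sub_one (hcent h), smul_add, smul_smul, smul_smul, add_assoc,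
      ← add_smul] at h1
    obtain ⟨h2, h3⟩ := coeff_unique hx0 h1
    refine ⟨by rw [h2, mul_comm], hγ_ext (fun ha => ?_) h3⟩
    rw [hγ1 ha, hγ1 ha, mul_zero, add_zero]
  have ha := coeff_unique hx0 (β' := q) (γ' := 0) (a := a) ((hβγ a).symm.trans
    (hq.trans (by rw [zero_smul, add_zero])))
  have h1 : β 1 = 1 := by
    have h := hβγ 1
    rw [inv_one, GroupLike.val_one, one_mul, mul_one] at h
    exact (coeff_unique hx0 (β' := 1) (γ' := 0) (a := a) (h.symm.trans
      (by rw [zero_smul, add_zero, one_smul]))).1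
  refine ⟨MonoidHom.toHomUnits ⟨⟨β, h1⟩, fun h g => (hmul h g).1⟩, γ, ?_, ha.1,
    hγ_ext (fun _ => rfl) ha.2, fun h g => (hmul h g).2, hβγ⟩
  exact Subgroup.mem_center_iff.2 fun g => by
    rw [← mul_inv_eq_iff_eq_mul, hcent]

theorem adjoin_insert_groupLike (hp : IsPointed k H) (hr : HasRank k H 1)
    (hgen : Algebra.adjoin k (coradicalFiltration k H 1 : Set H) = ⊤)
    (hx : x ∈ skewPrimitives k a 1) (hx0 : x ∉ coradical k H) :
    Algebra.adjoin k (insert x (Set.range (GroupLike.val (R := k) (A := H)))) = ⊤ := by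
  rw [eq_top_iff, ← hgen, Algebra.adjoin_le_iff]
  set A := Algebra.adjoin k (insert x (Set.range (GroupLike.val (R := k) (A := H))))
  have hg : ∀ g : GroupLike k H, (g : H) ∈ A := fun g => Algebra.subset_adjoin (Or.inr ⟨g, rfl⟩)
  have hxA : x ∈ A := Algebra.subset_adjoin (Or.inl rfl)
  refine (filtration_one_le_span hp hr hx hx0).trans (sup_le ?_ ?_ : _ ≤ A.toSubmodule)
  · rw [coradical_eq_span_groupLike hp, Submodule.span_le]
    rintro _ ⟨g, rfl⟩
    exact hg g
  · rw [Submodule.span_le]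
    rintro _ ⟨g, rfl⟩
    exact A.mul_mem (hg g) hxA

end Hopf

/-! ### The two types -/

theorem qbinom_one_ne_zero {k : Type*} [Field k] {q : k} {N m : ℕ}
    (hq : IsPrimitiveRoot q N) (hm : m + 1 < N) : qbinom q (m + 1) 1 ≠ 0 := by
  intro h0
  have h := qbinom_mul q m 0
  rw [zero_add, h0, zero_mul, qbinom_zero_right, mul_one] at h
  exact hq.pow_ne_one_of_pos_of_lt (by lia) hm (sub_eq_zero.1 h.symm)

theorem qbinom_one_one {k : Type*} [Field k] (m : ℕ) : qbinom (1 : k) m 1 = m := by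
  induction m with
  | zero => simp [qbinom]
  | succ m ih =>
    rw [show qbinom (1 : k) (m + 1) 1 = qbinom 1 m 0 + 1 ^ 1 * qbinom 1 m 1 from rfl, ih,
      qbinom_zero_right]
    push_cast; ring

section Hopf

variable {k : Type u} {H : Type v} [Field k] [Ring H] [HopfAlgebra k H] [FiniteDimensional k H]
  {a : GroupLike k H} {x : H} (p : ℕ) [Fact p.Prime] [CharP k p]

/-- For `q ≠ 1` the cocycle vanishes because `a` is central, and `x ^ N` lies in `H₀` because `a`
commutes with `x ^ N` but not with `x`. -/
theorem exists_firstType (hp : IsPointed k H) (hr : HasRank k H 1)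
    (hgen : Algebra.adjoin k (coradicalFiltration k H 1 : Set H) = ⊤)
    (hx : x ∈ skewPrimitives k a 1) (hx0 : x ∉ coradical k H) {q : k}
    (hq : (a : H) * x * ((a⁻¹ : GroupLike k H) : H) = q • x) (hq1 : q ≠ 1) :
    ∃ R : FirstType k p (GroupLike k H),
      R.r = 0 ∧ R.toDatum.MonomialsFormBasis ∧ Nonempty (H ≃ₐc[k] R.HR) := by
  classical
  obtain ⟨χ, c, hac, hχa, hca, hc, hconj⟩ := exists_character hp hr hx hx0 hq
  have hc0 : ∀ g, c g = 0 := by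
    intro g
    have h1 := hc a g
    rw [← Subgroup.mem_center_iff.1 hac g, hc g a, hca, hχa, mul_zero, add_zero, zero_add] at h1
    by_contra h0
    exact hq1 (mul_right_cancel₀ h0 (h1.trans (one_mul _).symm))
  simp only [hc0, zero_smul, add_zero] at hconj
  set n := p ^ 0 * orderOf (χ a) with hn
  have hN : 0 < orderOf (χ a) := orderOf_pos_iff.2 (χ.isOfFinOrder (isOfFinOrder_of_finite a))
  have hprim : IsPrimitiveRoot q (orderOf (χ a)) := by
    rw [← hχa]
    exact IsPrimitiveRoot.coe_units_iff.2 (IsPrimitiveRoot.orderOf _)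
  have hnN : n = orderOf (χ a) := by rw [hn, pow_zero, one_mul]
  have hax := groupLike_mul_of_conj hq
  have hqn : q ^ n = 1 := by rw [hnN, hprim.pow_eq_one]
  have hcent : ∀ g : GroupLike k H, g * a ^ n * g⁻¹ = a ^ n := fun g => by
    rw [Subgroup.mem_center_iff.1 (pow_mem hac n) g, mul_inv_cancel_right]
  obtain ⟨β, γ, hβγ, hβ⟩ := skewPrimitive_eq hp hr hx hx0
    (pow_mem_skewPrimitives p hx hax hN hprim 0)
  rw [← hn] at hβγ hβ
  have hβ0 : β = 0 := by
    have h := conj_npow a x n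
    rw [hq, smul_pow, hqn, one_smul, hβγ, mul_add, add_mul, mul_smul_comm, smul_mul_assoc, hq,
      mul_smul_comm, smul_mul_assoc, conj_sub_one (hcent a), smul_smul] at h
    have h' := (coeff_unique hx0 h).1
    by_contra h0
    exact hq1 (mul_left_cancel₀ h0 (h'.symm.trans (mul_one _).symm))
  rw [hβ0, zero_smul, zero_add] at hβγ
  -- If `a ^ n = 1`, the scalar has to be normalized to zero.
  let α : k := if a ^ n = 1 then 0 else γ
  have hα : x ^ n = α • (((a ^ n : GroupLike k H) : H) - 1) := by
    by_cases h : a ^ n = 1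
    · rw [hβγ, h, GroupLike.val_one, sub_self, smul_zero, smul_zero]
    · rw [hβγ]; simp only [α, if_neg h]
  let R : FirstType k p (GroupLike k H) :=
    { χ := χ
      a := a
      r := 0
      αneg := α
      α := Fin.elim0
      a_central := hac
      χ_a := fun h => hq1 (by rw [← hχa, h, Units.val_one])
      αneg_eq_zero := fun h => if_pos h
      pow_a := fun i => i.elim0
      pow_χ := fun i => i.elim0
      pow_χ_neg := fun h0 g => by
        have han : a ^ n ≠ 1 := fun h => h0 (if_pos h)
        have h := conj_npow g x n
        rw [hconj, smul_pow, hα, mul_smul_comm, smul_mul_assoc, conj_sub_one (hcent g),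
          smul_smul] at h
        have h' := smul_left_injective k (groupLike_sub_one_ne_zero han) h
        rw [mul_comm _ (p ^ 0), ← hn]
        apply Units.ext
        rw [Units.val_pow_eq_pow_val, Units.val_one]
        exact mul_right_cancel₀ h0 (h'.trans (one_mul _).symm) }
  refine ⟨R, rfl, R.toDatum.monomialsFormBasis_and_nonempty_equiv hx (fun g => ?_) ?_
    (linearIndependent_monomials hp hx hx0 hax n fun m hm =>
      qbinom_one_ne_zero hprim (hnN ▸ hm)) (adjoin_insert_groupLike hp hr hgen hx hx0)⟩
  · rw [hconj, show R.toDatum.c g = 0 from rfl, zero_smul, add_zero]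
    rfl
  · change x ^ n = α • ((a : H) ^ n - 1) + ∑ i : Fin 0, _
    rw [Finset.univ_eq_empty, Finset.sum_empty, add_zero, hα, GroupLike.val_pow]

/-- The case `q = 1` for a skew primitive element `x` with normalized `p`-th power; `α'` and
`α` are the scalars `α₋₁` and `α₀` of the tuple. -/
theorem exists_secondType_of_normalized (hp : IsPointed k H) (hr : HasRank k H 1)
    (hgen : Algebra.adjoin k (coradicalFiltration k H 1 : Set H) = ⊤)
    (hx : x ∈ skewPrimitives k a 1) (hx0 : x ∉ coradical k H)
    (hq : (a : H) * x * ((a⁻¹ : GroupLike k H) : H) = x) {α α' : k}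
    (hα : α = 0 ∧ α' = 0 ∨ α = 1 ∧ a ^ p = a)
    (hpow : x ^ p = α' • ((a : H) ^ p - 1) + α • x) :
    ∃ F : SecondType k p (GroupLike k H),
      F.toDatum.MonomialsFormBasis ∧ Nonempty (H ≃ₐc[k] F.HF) := by
  have hq : (a : H) * x * ((a⁻¹ : GroupLike k H) : H) = (1 : k) • x := by rw [hq, one_smul]
  obtain ⟨χ, c, hac, hχa, hca, hc, hconj⟩ := exists_character hp hr hx hx0 hq
  have hax := groupLike_mul_of_conj hq
  have hprime : p.Prime := Fact.out
  have hcomm : Commute x ((a : H) - 1) := by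
    have : Commute x (a : H) := by rw [one_smul] at hax; exact hax.symm
    exact this.sub_right (Commute.one_right x)
  have hcent : ∀ g : GroupLike k H, g * a * g⁻¹ = a := fun g => by
    rw [Subgroup.mem_center_iff.1 hac g, mul_inv_cancel_right]
  have hsub : ((a : H) - 1) ^ p = (a : H) ^ p - 1 := by
    have : Nontrivial H := nontrivial_of_ne x 0 fun h => hx0 (h ▸ zero_mem _)
    have : CharP H p := charP_of_injective_algebraMap (algebraMap k H).injective p
    rw [sub_pow_char_of_commute p (Commute.one_right _), one_pow]
  -- Both expressions for `g xᵖ g⁻¹`.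
  have hgp : ∀ g : GroupLike k H, (g : H) * x ^ p * ((g⁻¹ : GroupLike k H) : H)
      = (χ g : k) ^ p • x ^ p + c g ^ p • ((a : H) ^ p - 1) := by
    intro g
    have h := add_pow_char_pow_aux (k := k) p
      ((hcomm.smul_left (χ g : k)).smul_right (c g)) 1
    rw [← conj_npow, hconj]
    rwa [pow_one, smul_pow, smul_pow, hsub] at h
  have hone : α = 1 → ∀ g : GroupLike k H, (χ g : k) ^ p = χ g ∧
      (α' * ((χ g : k) - 1) + c g ^ p - c g) • ((a : H) - 1) = 0 := by
    intro h1 g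
    have hap : a ^ p = a := hα.elim (fun h => absurd (h.1.symm.trans h1) zero_ne_one) (·.2)
    have h := hgp g
    rw [hpow, h1, one_smul, ← GroupLike.val_pow, hap, mul_add, add_mul, hconj, mul_smul_comm,
      smul_mul_assoc, conj_sub_one (hcent g), smul_add, smul_smul] at h
    have h' : (χ g : k) • x + (α' + c g) • ((a : H) - 1)
        = (χ g : k) ^ p • x + ((χ g : k) ^ p * α' + c g ^ p) • ((a : H) - 1) := by
      rw [add_smul, add_smul, add_left_comm, h]; abel
    obtain ⟨h2, h3⟩ := coeff_unique hx0 h'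
    refine ⟨h2.symm, ?_⟩
    rw [← h2, ← sub_eq_zero, ← sub_smul] at h3
    rw [← neg_eq_zero, ← neg_smul, ← h3]
    congr 1; ring
  let F : SecondType k p (GroupLike k H) :=
    { χ := χ
      c := c
      a := a
      αneg := α'
      α := α
      a_central := hac
      χ_a := Units.ext hχa
      c_mul := hc
      c_a := hca
      α_zero_or_one := hα.imp (·.1) (·.1)
      αneg_eq_zero := fun h0 => hα.elim (·.2) fun h => absurd (h0.symm.trans h.1) zero_ne_one
      of_zero := fun h0 g => by
        have h0' : α' = 0 := hα.elim (·.2) fun h => absurd (h0.symm.trans h.1) zero_ne_one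
        by_cases hap : a ^ p = 1
        · rw [hap, map_one, sub_self, smul_zero]
        · have h := hgp g
          rw [hpow, h0, h0', zero_smul, zero_smul, add_zero, mul_zero, zero_mul, smul_zero,
            zero_add, ← GroupLike.val_pow] at h
          have hcg := (smul_eq_zero.1 h.symm).resolve_right (groupLike_sub_one_ne_zero hap)
          rw [eq_zero_of_pow_eq_zero hcg, zero_smul]
      pow_a := fun h1 => hα.elim (fun h => absurd (h.1.symm.trans h1) zero_ne_one) (·.2)
      χ_prime := fun h1 g => (Subfield.mem_bot_iff_pow_eq_self k p).2 (hone h1 g).1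
      of_one := fun h1 g => by
        by_cases ha : a = 1
        · rw [ha, map_one, sub_self, smul_zero]
        · rw [(smul_eq_zero.1 (hone h1 g).2).resolve_right (groupLike_sub_one_ne_zero ha),
            zero_smul] }
  have hnp : p ^ 1 * 1 = p := by rw [pow_one, mul_one]
  refine ⟨F, F.toDatum.monomialsFormBasis_and_nonempty_equiv hx hconj ?_
    (linearIndependent_monomials hp hx hx0 hax (p ^ 1 * 1) fun m hm => ?_)
    (adjoin_insert_groupLike hp hr hgen hx hx0)⟩
  · change x ^ (p ^ 1 * 1) = α' • ((a : H) ^ (p ^ 1 * 1) - 1)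
      + ∑ i : Fin 1, α • x ^ (p ^ (i : ℕ) * 1)
    simpa only [pow_one, mul_one, Fin.sum_univ_one, Fin.val_zero, pow_zero] using hpow
  · rw [hnp] at hm
    rw [qbinom_one_one, Ne, CharP.cast_eq_zero_iff k p]
    exact fun hdvd => absurd (Nat.le_of_dvd (by lia) hdvd) (by lia)

/-- For `q = 1` the power `xᵖ` is `β x + γ (aᵖ - 1)`. Over an algebraically closed field, `γ` can be
removed by a translation of `x` if `β = 0`, and otherwise `β` becomes `1` after rescaling `x`. -/
theorem exists_secondType [IsAlgClosed k] (hp : IsPointed k H) (hr : HasRank k H 1)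
    (hgen : Algebra.adjoin k (coradicalFiltration k H 1 : Set H) = ⊤)
    (hx : x ∈ skewPrimitives k a 1) (hx0 : x ∉ coradical k H)
    (hq : (a : H) * x * ((a⁻¹ : GroupLike k H) : H) = x) :
    ∃ F : SecondType k p (GroupLike k H),
      F.toDatum.MonomialsFormBasis ∧ Nonempty (H ≃ₐc[k] F.HF) := by
  have hprime : p.Prime := Fact.out
  have hax : (a : H) * x = (1 : k) • (x * (a : H)) :=
    groupLike_mul_of_conj (hq.trans (one_smul k x).symm)
  have hxp := pow_mem_skewPrimitives p hx hax Nat.one_pos IsPrimitiveRoot.one 1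
  rw [pow_one, mul_one] at hxp
  obtain ⟨β, γ, hβγ, hβ⟩ := skewPrimitive_eq hp hr hx hx0 hxp
  rw [GroupLike.val_pow] at hβγ
  have hxa : (a : H) - 1 ∈ coradical k H :=
    sub_mem (groupLike_mem_coradical a) one_mem_coradical
  by_cases hβ0 : β = 0
  · rw [hβ0, zero_smul, zero_add] at hβγ
    obtain ⟨δ, hδ⟩ := IsAlgClosed.exists_pow_nat_eq γ hprime.pos
    refine exists_secondType_of_normalized p hp hr hgen (a := a) (x := x - δ • ((a : H) - 1)) ?_
      (fun h => hx0 ?_) ?_ (Or.inl ⟨rfl, rfl⟩) ?_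
    · change Coalgebra.comul (R := k) _ = _
      rw [map_sub, map_smul, map_sub, show Coalgebra.comul (R := k) x = _ from hx,
        a.2.comul_eq_tmul_self, Bialgebra.comul_one, Algebra.TensorProduct.one_def,
        GroupLike.val_one]
      simp only [TensorProduct.sub_tmul, TensorProduct.tmul_sub, ← TensorProduct.smul_tmul',
        TensorProduct.tmul_smul, smul_sub]
      abel
    · exact (sub_add_cancel x (δ • ((a : H) - 1))) ▸ add_mem h (Submodule.smul_mem _ _ hxa)
    · rw [mul_sub, sub_mul, hq, mul_smul_comm, smul_mul_assoc,
        conj_sub_one (mul_inv_cancel_right a a)]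
    · have : Nontrivial H := nontrivial_of_ne x 0 fun h => hx0 (h ▸ zero_mem _)
      have : CharP H p := charP_of_injective_algebraMap (algebraMap k H).injective p
      have hcomm : Commute x (a : H) := by rw [one_smul] at hax; exact hax.symm
      rw [sub_pow_char_of_commute p
        ((hcomm.sub_right (Commute.one_right x)).smul_right δ), smul_pow,
        sub_pow_char_of_commute p (Commute.one_right _), one_pow, hδ, hβγ, sub_self,
        zero_smul, zero_smul, add_zero]
  · have hap : a ^ p = a := hβ hβ0
    obtain ⟨s, hs⟩ := IsAlgClosed.exists_pow_nat_eq β⁻¹ (Nat.sub_pos_of_lt hprime.one_lt)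
    have hs0 : s ≠ 0 := by
      rintro rfl
      rw [zero_pow (Nat.sub_pos_of_lt hprime.one_lt).ne'] at hs
      exact inv_ne_zero hβ0 hs.symm
    have hsp : s ^ p * β = s := by
      rw [← Nat.sub_add_cancel hprime.one_le, pow_succ, hs, mul_right_comm, inv_mul_cancel₀ hβ0,
        one_mul]
    refine exists_secondType_of_normalized p hp hr hgen (a := a) (x := s • x) (α' := s ^ p * γ) ?_
      (fun h => hx0 (((coradical k H).smul_mem_iff hs0).1 h)) ?_ (Or.inr ⟨rfl, hap⟩) ?_
    · change Coalgebra.comul (R := k) _ = _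
      rw [map_smul, show Coalgebra.comul (R := k) x = _ from hx, smul_add,
        TensorProduct.smul_tmul', TensorProduct.tmul_smul]
    · rw [mul_smul_comm, smul_mul_assoc, hq]
    · rw [smul_pow, hβγ, smul_add, smul_smul, smul_smul, hsp, one_smul, add_comm]

end Hopf

end RankOne

end

theorem mainTheorem2 {k : Type u} [Field k] (p : ℕ) [Fact p.Prime] [CharP k p]
    {H : Type v} [Ring H] [HopfAlgebra k H] [FiniteDimensional k H]
    (hpointed : RankOne.IsPointed k H) (hrank : RankOne.HasRank k H 1)
    (hgen : Algebra.adjoin k (RankOne.coradicalFiltration k H 1 : Set H) = ⊤)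
    (a : GroupLike k H) (x : H) (hx : x ∈ RankOne.skewPrimitives k a 1)
    (hx0 : x ∉ RankOne.coradicalFiltration k H 0)
    (q : k) (hq : (a : H) * x * ((a⁻¹ : GroupLike k H) : H) = q • x) :
    (q ≠ 1 → ∃ (G : Type v) (_ : Group G) (_ : Finite G) (R : RankOne.FirstType k p G),
      R.r = 0 ∧ R.toDatum.MonomialsFormBasis ∧ Nonempty (H ≃ₐc[k] R.HR)) ∧
    (q = 1 → IsAlgClosed k →
      ∃ (G : Type v) (_ : Group G) (_ : Finite G) (F : RankOne.SecondType k p G),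
        F.toDatum.MonomialsFormBasis ∧ Nonempty (H ≃ₐc[k] F.HF)) := by
  refine ⟨fun hq1 => ⟨GroupLike k H, inferInstance, inferInstance,
    RankOne.exists_firstType p hpointed hrank hgen hx hx0 hq hq1⟩, fun hq1 _ =>
    ⟨GroupLike k H, inferInstance, inferInstance,
    RankOne.exists_secondType p hpointed hrank hgen hx hx0 ?_⟩⟩
  rw [hq, hq1, one_smul]
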